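/- For a probability distribution $P=(p_i)_{i=1}^{d}$ let $|\psi_P\rangle=\sum_i\sqrt{p_i}\,|ii\rangle\in\mathbb C^d\otimes\mathbb C^d$. For $\alpha\in[0,1)$ let $H_\alpha(P)=\frac{1}{1-\alpha}\log\sum_{i}p_i^\alpha$ (sum over $i$ with $p_i\neq0$), and let $H_1(P)=-\sum_i p_i\log p_i$. For a bipartite vector $|\psi\rangle$ let $f_\alpha(|\psi\rangle)=\operatorname{Tr}\big[(\operatorname{Tr}_2|\psi\rangle\langle\psi|)^\alpha\big]$, the power being taken on the support (so $f_0$ is the Schmidt rank). For bipartite vectors, $|\psi\rangle\xrightarrow{\mathrm{LOCC}}|\phi\rangle$ means that some LOCC channel maps $|\psi\rangle\langle\psi|$ to $|\phi\rangle\langle\phi|$. An LOCC channel is a composition of finitely many one-step channels $$\rho\mapsto\sum_{j\in J}\big((K_j)_i\otimes|g(j)\rangle\langle f(j)|\big)\,\rho\,\big((K_j^*)_i\otimes|f(j)\rangle\langle g(j)|\big)$$ between spaces $\mathcal B(\mathcal H_1)\otimes\mathcal B(\mathcal H_2)\otimes\operatorname{Diag}(\mathbb C^{\mathcal X})$ with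 $\mathcal H_1,\mathcal H_2$ finite dimensional and $\mathcal X$ a finite classical register. Here $J$ is finite, $f$ and $g$ map $J$ to the input and the output register, $(K_j)_i$ is a linear map $K_j$ acting on one party $i$ only, and $\sum_j K_j^*K_j\otimes|f(j)\rangle\langle f(j)|\le I$. Such channels need not preserve the trace: a conversion $\sqrt{x}\,|\psi\rangle\xrightarrow{\mathrm{LOCC}}|\phi\rangle$ with $|\psi\rangle,|\phi\rangle$ normalized and $x\ge1$ converts $|\psi\rangle$ into $|\phi\rangle$ with success probability $1/x$. For vectors $|\psi\rangle$ and $|\phi\rangle$ that are initial and final states of a conversion, the registers have one point. **Proposition.** Let $P=(p_i)_{i=1}^{d_1}$ and $Q=(q_i)_{i=1}^{d_2}$ be probability distributions, where $Q$ is not a point mass. Then $$\inf_{\alpha\in[0,1)}\frac{\log f_\alpha(|\psi_P\rangle)}{\log f_\alpha(|\psi_Q\rangle)}=\inf_{\alpha\in[0,1)}\frac{\log\sum_i p_i^\alpha}{\log\sum_i q_i^\alpha}=\min_{\alpha\in[0,1]}\frac{H_\alpha(P)}{H_\alpha(Q)},$$ and the minimum is attained. If it is $>1$, then there is a sequence of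 reals $x_n\ge1$ with $x_n\to1$ such that, for all sufficiently large $n$, $$\sqrt{x_n}\,|\psi_P\rangle^{\otimes n}\xrightarrow{\mathrm{LOCC}}|\psi_Q\rangle^{\otimes n}.$$ **Corollary.** Let $|\psi\rangle$ and $|\phi\rangle$ be normalized bipartite vectors in tensor products of finite dimensional Hilbert spaces, where $|\phi\rangle$ is not a product vector. Let $n\ge1$ and $m\ge0$ be integers with $$\frac mn<\inf_{\alpha\in[0,1)}\frac{\log f_\alpha(|\psi\rangle)}{\log f_\alpha(|\phi\rangle)}.$$ Then there is a sequence of reals $x_k\ge1$ with $x_k\to1$ such that, for all $k$, $$\sqrt{x_k}\,|\psi\rangle^{\otimes nk}\xrightarrow{\mathrm{LOCC}}|\phi\rangle^{\otimes mk}.$$ -/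

import Mathlib

open Filter Topology
open scoped Matrix Kronecker ComplexOrder

namespace LOCC

/-- The data of a bipartite state space `B(H₁) ⊗ B(H₂) ⊗ Diag(ℂ^X)`: the finite dimensional Hilbert
spaces of the two parties are `H₁ = ℂ^A` and `H₂ = ℂ^B`, and `X` is the classical register. -/
structure StateSpace where
  A : Type
  B : Type
  X : Type
  [fintypeA : Fintype A]
  [fintypeB : Fintype B]
  [fintypeX : Fintype X]
  [decEqA : DecidableEq A]
  [decEqB : DecidableEq B]
  [decEqX : DecidableEq X]

attribute [instance] StateSpace.fintypeA StateSpace.fintypeB StateSpace.fintypeX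
  StateSpace.decEqA StateSpace.decEqB StateSpace.decEqX

/-- Elements of `B(H₁) ⊗ B(H₂) ⊗ Diag(ℂ^X)`. The function `ρ` stands for `∑ x, ρ x ⊗ |x⟩⟨x|`. -/
abbrev StateSpace.Op (S : StateSpace) : Type :=
  S.X → Matrix (S.A × S.B) (S.A × S.B) ℂ

/-- One-step LOCC channels. One party applies Kraus operators `K j`, `j ∈ J`, each of which is
conditioned on the value `f j` of the register and writes the value `g j` into it:
`ρ ↦ ∑ j, (K j ⊗ |g j⟩⟨f j|) ρ (K j ⊗ |g j⟩⟨f j|)ᴴ`.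
The constraint `∑ j, (K j)ᴴ (K j) ⊗ |f j⟩⟨f j| ≤ I` is block diagonal in the register, and is
imposed on every block. -/
inductive IsOneStep : (S T : StateSpace) → (S.Op → T.Op) → Prop
  | first {A A' B X Y J : Type} [Fintype A] [Fintype A'] [Fintype B] [Fintype X] [Fintype Y]
      [Fintype J] [DecidableEq A] [DecidableEq A'] [DecidableEq B] [DecidableEq X] [DecidableEq Y]
      (K : J → Matrix A' A ℂ) (f : J → X) (g : J → Y)
      (hK : ∀ x, (1 - ∑ j with f j = x, (K j)ᴴ * K j).PosSemidef) :
      IsOneStep ⟨A, B, X⟩ ⟨A', B, Y⟩ (fun ρ y => ∑ j with g j = y,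
        (K j ⊗ₖ (1 : Matrix B B ℂ)) * ρ (f j) * (K j ⊗ₖ (1 : Matrix B B ℂ))ᴴ)
  | second {A B B' X Y J : Type} [Fintype A] [Fintype B] [Fintype B'] [Fintype X] [Fintype Y]
      [Fintype J] [DecidableEq A] [DecidableEq B] [DecidableEq B'] [DecidableEq X] [DecidableEq Y]
      (K : J → Matrix B' B ℂ) (f : J → X) (g : J → Y)
      (hK : ∀ x, (1 - ∑ j with f j = x, (K j)ᴴ * K j).PosSemidef) :
      IsOneStep ⟨A, B, X⟩ ⟨A, B', Y⟩ (fun ρ y => ∑ j with g j = y,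
        ((1 : Matrix A A ℂ) ⊗ₖ K j) * ρ (f j) * ((1 : Matrix A A ℂ) ⊗ₖ K j)ᴴ)

/-- LOCC channels: compositions of finitely many composable one-step LOCC channels. -/
inductive IsChannel : (S T : StateSpace) → (S.Op → T.Op) → Prop
  | oneStep {S T : StateSpace} {Λ : S.Op → T.Op} (h : IsOneStep S T Λ) : IsChannel S T Λ
  | comp {S T U : StateSpace} {Λ : S.Op → T.Op} {Λ' : T.Op → U.Op}
      (h : IsChannel S T Λ) (h' : IsOneStep T U Λ') : IsChannel S U (Λ' ∘ Λ)

/-- The operator `|ψ⟩⟨ψ|` of a vector `ψ ∈ ℂ^A ⊗ ℂ^B = ℂ^(A × B)`. -/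
def pureState {A B : Type} (ψ : A × B → ℂ) : Matrix (A × B) (A × B) ℂ :=
  Matrix.vecMulVec ψ (star ψ)

/-- `|ψ⟩ → |φ⟩` under LOCC: some LOCC channel between the state spaces with one-point registers
maps `|ψ⟩⟨ψ|` to `|φ⟩⟨φ|`. -/
def Converts {A B A' B' : Type} [Fintype A] [Fintype B] [Fintype A'] [Fintype B']
    [DecidableEq A] [DecidableEq B] [DecidableEq A'] [DecidableEq B']
    (ψ : A × B → ℂ) (φ : A' × B' → ℂ) : Prop :=
  ∃ Λ : (StateSpace.mk A B Unit).Op → (StateSpace.mk A' B' Unit).Op,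
    IsChannel (StateSpace.mk A B Unit) (StateSpace.mk A' B' Unit) Λ ∧
      Λ (fun _ => pureState ψ) = fun _ => pureState φ

/-- The bipartite vector `|ψ⟩^{⊗ n} ∈ (ℂ^A)^{⊗ n} ⊗ (ℂ^B)^{⊗ n}`. -/
def tensorPow {A B : Type} (n : ℕ) (ψ : A × B → ℂ) : (Fin n → A) × (Fin n → B) → ℂ :=
  fun p => ∏ k, ψ (p.1 k, p.2 k)

/-- The vector `|ψ_P⟩ = ∑ i, √(P i) |i i⟩`. -/
noncomputable def ket {d : ℕ} (P : Fin d → ℝ) : Fin d × Fin d → ℂ :=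
  fun p => if p.1 = p.2 then ((Real.sqrt (P p.1) : ℝ) : ℂ) else 0

/-- The partial trace over the second system. -/
def partialTrace {A B : Type} [Fintype B] (M : Matrix (A × B) (A × B) ℂ) : Matrix A A ℂ :=
  Matrix.of fun a a' => ∑ b, M (a, b) (a', b)

theorem isHermitian_partialTrace_pureState {A B : Type} [Fintype B] (ψ : A × B → ℂ) :
    (partialTrace (pureState ψ)).IsHermitian := by
  ext a a'
  simp [partialTrace, pureState, Matrix.vecMulVec_apply, mul_comm]

/-- `f_α(ψ) = Tr[(Tr₂ |ψ⟩⟨ψ|)^α]`, where the power is taken on the support, so that `f_0(ψ)` is the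
Schmidt rank. -/
noncomputable def f {A B : Type} [Fintype A] [Fintype B] [DecidableEq A]
    (α : ℝ) (ψ : A × B → ℂ) : ℝ :=
  ∑ i with (isHermitian_partialTrace_pureState ψ).eigenvalues i ≠ 0,
    (isHermitian_partialTrace_pureState ψ).eigenvalues i ^ α

/-- `∑ i, (P i)^α`, over the support of `P` (this only matters for `α = 0`). -/
noncomputable def powerSum {d : ℕ} (α : ℝ) (P : Fin d → ℝ) : ℝ :=
  ∑ i with P i ≠ 0, P i ^ α

/-- The Rényi entropy `H_α(P)`, which for `α = 1` is the Shannon entropy. The base of the logarithm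
is immaterial, since only quotients of logarithms occur. -/
noncomputable def renyi {d : ℕ} (α : ℝ) (P : Fin d → ℝ) : ℝ :=
  if α = 1 then -∑ i, P i * Real.log (P i) else 1 / (1 - α) * Real.log (powerSum α P)

end LOCC

/-! Let `v` and `u` be the squared Schmidt coefficients of two bipartite vectors. The first vector
converts to the second as soon as `∑ min (u i) t ≤ ∑ min (v i) t` for all `t > 0`
(`converts_of_hasSchmidt`). Under this condition `u`, padded with zeros, has a convex combination of
rearrangements lying below `v` (`exists_weights_perm`, by separation of convex sets). The weights
and permutations give a measurement for the first party, and the second party then relabels its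
basis.

For tensor powers, put `t = exp (-N τ)`. The truncated sum for `q` is at most `(∑ q^β)^M t^(1-β)`
for every `β ∈ [0,1]`, because a minimum is at most any weighted geometric mean (`sum_min_prod_le`).
For `p` this bound is exponentially tight when `-log p` has mean `τ` under the distribution
proportional to `p^α`, by the law of large numbers (`le_sum_min_prod`). With `β = α` the exponents
per copy differ by `log ∑ p^α - r log ∑ q^α = (1-α) (H_α(p) - r H_α(q))`. This is positive for `α <
1` and bounded below by compactness away from `α = 1` (`exists_exponent_gap`).

Near `τ = H_1(p)` this gap degenerates, and one compares the full mass of `p` with some `β < 1` for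
`q`. For smaller `τ`, truncation removes only `O(1/N)` of the mass of `p`. A scalar `x N → 1` makes
up for this loss, and finitely many small `N` are absorbed in a cruder scalar
(`exists_tendsto_sum_min_le`). -/

namespace LOCC

/-! ### Product weights and the law of large numbers -/

section Weights
variable {ι : Type*} [Fintype ι]

theorem sum_fin_succ_pi {M : Type*} [AddCommMonoid M] (N : ℕ) (F : (Fin (N + 1) → ι) → M) :
    ∑ a, F a = ∑ i, ∑ a : Fin N → ι, F (Fin.cons i a) := by
  rw [← Fintype.sum_prod_type', ← (Fin.consEquiv fun _ : Fin (N + 1) => ι).sum_comp]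
  rfl

theorem sum_prod_pi (N : ℕ) (w : ι → ℝ) : ∑ a : Fin N → ι, ∏ k, w (a k) = (∑ i, w i) ^ N := by
  classical
  rw [← Fintype.piFinset_univ, ← Finset.prod_univ_sum]
  simp

/-- Additivity of the variance for independent centred variables: the cross terms vanish by `hX`. -/
theorem sum_prod_mul_sq_sum (w X : ι → ℝ) (hw : ∑ i, w i = 1) (hX : ∑ i, w i * X i = 0) (N : ℕ) :
    ∑ a : Fin N → ι, (∏ k, w (a k)) * (∑ k, X (a k)) ^ 2 = N * ∑ i, w i * X i ^ 2 := by
  induction N with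
  | zero => simp
  | succ N ih =>
    have h1 : ∑ a : Fin N → ι, ∏ k, w (a k) = 1 := by rw [sum_prod_pi, hw, one_pow]
    have key : ∀ i, ∑ a : Fin N → ι, (w i * ∏ k, w (a k)) * (X i + ∑ k, X (a k)) ^ 2 =
        w i * X i ^ 2 + w i * X i * (2 * ∑ a : Fin N → ι, (∏ k, w (a k)) * ∑ k, X (a k)) +
          w i * (N * ∑ i, w i * X i ^ 2) := by
      intro i
      rw [← ih, ← mul_one (w i * X i ^ 2), ← h1, Finset.mul_sum, Finset.mul_sum, Finset.mul_sum,
        Finset.mul_sum, ← Finset.sum_add_distrib, ← Finset.sum_add_distrib]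
      exact Finset.sum_congr rfl fun a _ => by ring
    rw [sum_fin_succ_pi]
    simp only [Fin.prod_univ_succ, Fin.sum_univ_succ, Fin.cons_zero, Fin.cons_succ, key]
    rw [Finset.sum_add_distrib, Finset.sum_add_distrib, ← Finset.sum_mul, ← Finset.sum_mul, hX, hw]
    push_cast
    ring

/-- The weak law of large numbers for a finite probability space. -/
theorem one_sub_le_sum_typical (w L : ι → ℝ) (hw0 : ∀ i, 0 ≤ w i) (hw : ∑ i, w i = 1) {m B δ : ℝ}
    (hm : ∑ i, w i * L i = m) (hB : ∀ i, |L i - m| ≤ B) (hδ : 0 < δ) {N : ℕ} (hN : 0 < N) :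
    1 - B ^ 2 / (N * δ ^ 2) ≤
      ∑ a : Fin N → ι with |∑ k, L (a k) - N * m| ≤ N * δ, ∏ k, w (a k) := by
  have hN' : (0 : ℝ) < N := by exact_mod_cast hN
  have h2 := sum_prod_mul_sq_sum w (fun i => L i - m) hw
    (by simp only [mul_sub, Finset.sum_sub_distrib, ← Finset.sum_mul, hm, hw]; ring) N
  have h3 : ∑ i, w i * (L i - m) ^ 2 ≤ B ^ 2 := by
    calc _ ≤ ∑ i, w i * B ^ 2 := Finset.sum_le_sum fun i _ =>
          mul_le_mul_of_nonneg_left (sq_le_sq' (abs_le.1 (hB i)).1 (abs_le.1 (hB i)).2) (hw0 i)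
      _ = B ^ 2 := by rw [← Finset.sum_mul, hw, one_mul]
  have h1 : ∑ a : Fin N → ι, ∏ k, w (a k) = 1 := by rw [sum_prod_pi, hw, one_pow]
  -- Chebyshev's inequality: outside the typical set the squared deviation is at least `(N * δ) ^
  -- 2`.
  have h4 : (N * δ) ^ 2 * ∑ a : Fin N → ι with ¬ |∑ k, L (a k) - N * m| ≤ N * δ, ∏ k, w (a k) ≤
      N * B ^ 2 := by
    calc _ ≤ ∑ a : Fin N → ι with ¬ |∑ k, L (a k) - N * m| ≤ N * δ,
            (∏ k, w (a k)) * (∑ k, (L (a k) - m)) ^ 2 := by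
          rw [Finset.mul_sum]
          refine Finset.sum_le_sum fun a ha => ?_
          rw [mul_comm]
          refine mul_le_mul_of_nonneg_left ?_ (Finset.prod_nonneg fun _ _ => hw0 _)
          have : ∑ k, (L (a k) - m) = ∑ k, L (a k) - N * m := by simp [Finset.sum_sub_distrib]
          rw [this, ← sq_abs (∑ k, L (a k) - N * m)]
          have := (Finset.mem_filter.1 ha).2
          exact pow_le_pow_left₀ (by positivity) (not_le.1 this).le 2
      _ ≤ ∑ a : Fin N → ι, (∏ k, w (a k)) * (∑ k, (L (a k) - m)) ^ 2 :=
          Finset.sum_le_sum_of_subset_of_nonneg (Finset.filter_subset _ _) fun a _ _ =>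
            mul_nonneg (Finset.prod_nonneg fun _ _ => hw0 _) (sq_nonneg _)
      _ ≤ N * B ^ 2 := by rw [h2]; exact mul_le_mul_of_nonneg_left h3 hN'.le
  rw [← Finset.sum_filter_add_sum_filter_not _ (fun a : Fin N → ι =>
    |∑ k, L (a k) - N * m| ≤ N * δ)] at h1
  have h5 : ∑ a : Fin N → ι with ¬ |∑ k, L (a k) - N * m| ≤ N * δ, ∏ k, w (a k) ≤
      B ^ 2 / (N * δ ^ 2) := by
    rw [le_div_iff₀ (by positivity)]
    refine le_of_mul_le_mul_left ?_ hN'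
    calc _ = (N * δ) ^ 2 * ∑ a : Fin N → ι with ¬ |∑ k, L (a k) - N * m| ≤ N * δ,
          ∏ k, w (a k) := by ring
      _ ≤ _ := h4
  linarith

end Weights

/-- The sum of the `α`-th powers of a family of positive reals. -/
noncomputable def rpowSum {ι : Type*} [Fintype ι] (p : ι → ℝ) (α : ℝ) : ℝ := ∑ i, p i ^ α

/-- The mean of `-log p` under the distribution proportional to `p ^ α`. -/
noncomputable def tiltedMean {ι : Type*} [Fintype ι] (p : ι → ℝ) (α : ℝ) : ℝ :=
  (∑ i, p i ^ α * -Real.log (p i)) / rpowSum p α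

theorem prod_rpow_pos {ι : Type*} {p : ι → ℝ} (hp : ∀ i, 0 < p i) {N : ℕ} (a : Fin N → ι) (α : ℝ) :
    (∏ k, p (a k)) ^ α = ∏ k, p (a k) ^ α :=
  (Real.finsetProd_rpow _ _ (fun _ _ => (hp _).le) α).symm

theorem prod_eq_exp_neg {ι : Type*} {p : ι → ℝ} (hp : ∀ i, 0 < p i) {N : ℕ} (a : Fin N → ι) :
    ∏ k, p (a k) = Real.exp (-∑ k, -Real.log (p (a k))) := by
  rw [Finset.sum_neg_distrib, neg_neg, Real.exp_sum]
  exact Finset.prod_congr rfl fun k _ => (Real.exp_log (hp _)).symm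

/-! ### Exponential bounds for truncated sums -/

section Bounds
variable {ι : Type*} [Fintype ι] {p : ι → ℝ}

theorem rpowSum_pos [Nonempty ι] (hp : ∀ i, 0 < p i) (α : ℝ) : 0 < rpowSum p α :=
  Finset.sum_pos (fun i _ => Real.rpow_pos_of_pos (hp i) α) Finset.univ_nonempty

theorem min_le_rpow_mul_rpow {a s α : ℝ} (ha : 0 < a) (hs : 0 < s) (h0 : 0 ≤ α) (h1 : α ≤ 1) :
    min a s ≤ a ^ α * s ^ (1 - α) := by
  have hm : 0 < min a s := lt_min ha hs
  calc min a s = min a s ^ α * min a s ^ (1 - α) := by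
        rw [← Real.rpow_add hm]; simp
    _ ≤ a ^ α * s ^ (1 - α) := mul_le_mul (Real.rpow_le_rpow hm.le (min_le_left _ _) h0)
        (Real.rpow_le_rpow hm.le (min_le_right _ _) (by linarith)) (by positivity) (by positivity)

/-- A Chernoff-type bound: each minimum is at most a weighted geometric mean of its two entries, and
the power sum is multiplicative. -/
theorem sum_min_prod_le (hp : ∀ i, 0 < p i) (N : ℕ) {s α : ℝ} (hs : 0 < s) (h0 : 0 ≤ α)
    (h1 : α ≤ 1) :
    ∑ a : Fin N → ι, min (∏ k, p (a k)) s ≤ rpowSum p α ^ N * s ^ (1 - α) := by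
  rw [rpowSum, ← sum_prod_pi, Finset.sum_mul]
  refine Finset.sum_le_sum fun a _ => ?_
  rw [← prod_rpow_pos hp]
  exact min_le_rpow_mul_rpow (Finset.prod_pos fun _ _ => hp _) hs h0 h1

theorem abs_sub_tiltedMean_le [Nonempty ι] (hp : ∀ i, 0 < p i) {B : ℝ}
    (hB : ∀ i, -Real.log (p i) ∈ Set.Icc 0 B) (α : ℝ) (i : ι) :
    |-Real.log (p i) - tiltedMean p α| ≤ B := by
  have hZ := rpowSum_pos hp α
  have h0 : 0 ≤ tiltedMean p α := div_nonneg (Finset.sum_nonneg fun i _ =>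
    mul_nonneg (Real.rpow_nonneg (hp i).le _) (hB i).1) hZ.le
  have h1 : tiltedMean p α ≤ B := by
    rw [tiltedMean, div_le_iff₀ hZ, mul_comm, rpowSum, Finset.sum_mul]
    exact Finset.sum_le_sum fun i _ =>
      mul_le_mul_of_nonneg_left (hB i).2 (Real.rpow_nonneg (hp i).le _)
  have := hB i
  rw [abs_le]
  constructor <;> linarith [this.1, this.2]

/-- The law of large numbers for the tilted distribution `p ^ α / rpowSum p α`, with the
normalization multiplied out. -/
theorem one_sub_le_sum_tilted [Nonempty ι] (hp : ∀ i, 0 < p i) {B : ℝ}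
    (hB : ∀ i, -Real.log (p i) ∈ Set.Icc 0 B) (α : ℝ) {δ : ℝ} (hδ : 0 < δ) {N : ℕ} (hN : 0 < N) :
    (1 - B ^ 2 / (N * δ ^ 2)) * rpowSum p α ^ N ≤
      ∑ a : Fin N → ι with |∑ k, -Real.log (p (a k)) - N * tiltedMean p α| ≤ N * δ,
        (∏ k, p (a k)) ^ α := by
  have hZ := rpowSum_pos hp α
  have h := one_sub_le_sum_typical (fun i => p i ^ α / rpowSum p α) (fun i => -Real.log (p i))
    (fun i => div_nonneg (Real.rpow_nonneg (hp i).le _) hZ.le)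
    (by rw [← Finset.sum_div]; exact div_self hZ.ne') (m := tiltedMean p α)
    (by rw [tiltedMean, Finset.sum_div]; exact Finset.sum_congr rfl fun i _ => by ring)
    (abs_sub_tiltedMean_le hp hB α) hδ hN
  refine (mul_le_mul_of_nonneg_right h (pow_pos hZ N).le).trans (le_of_eq ?_)
  rw [Finset.sum_mul]
  refine Finset.sum_congr rfl fun a _ => ?_
  rw [Finset.prod_div_distrib, prod_rpow_pos hp]
  simp [div_mul_cancel₀ _ (pow_pos hZ N).ne']

/-- The converse of `sum_min_prod_le` up to `2 * δ` in the exponent: only sequences typical for the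
tilted distribution are kept. One `δ` pays for the typical fluctuation, the other for the mismatch
between `τ` and the tilted mean. That mismatch counts with weight `1 - α` or `α`, so no match is
needed from above at `α = 1` or from below at `α = 0`. -/
theorem le_sum_min_prod [Nonempty ι] (hp : ∀ i, 0 < p i) {B : ℝ}
    (hB : ∀ i, -Real.log (p i) ∈ Set.Icc 0 B) {α τ δ : ℝ} (h0 : 0 ≤ α) (h1 : α ≤ 1) (hδ : 0 < δ)
    (hα : (1 - α) * (tiltedMean p α - τ) ≤ δ) (hα' : α * (τ - tiltedMean p α) ≤ δ)
    {N : ℕ} (hN : 0 < N) :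
    (1 - B ^ 2 / (N * δ ^ 2)) * rpowSum p α ^ N * Real.exp (-(N * ((1 - α) * τ + 2 * δ))) ≤
      ∑ a : Fin N → ι, min (∏ k, p (a k)) (Real.exp (-(N * τ))) := by
  have hN' : (0 : ℝ) < N := by exact_mod_cast hN
  refine (mul_le_mul_of_nonneg_right (one_sub_le_sum_tilted hp hB α hδ hN)
    (Real.exp_pos _).le).trans ?_
  rw [Finset.sum_mul]
  refine (Finset.sum_le_sum fun a ha => ?_).trans
    (Finset.sum_le_sum_of_subset_of_nonneg (Finset.filter_subset _ _) fun a _ _ =>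
      le_min (Finset.prod_nonneg fun _ _ => (hp _).le) (Real.exp_pos _).le)
  have ha' := abs_le.1 (Finset.mem_filter.1 ha).2
  rw [prod_eq_exp_neg hp, ← Real.exp_mul, ← Real.exp_add]
  set S := ∑ k, -Real.log (p (a k))
  have e1 : (1 - α) * (S - N * tiltedMean p α) ≤ N * δ := by
    nlinarith [mul_nonneg (sub_nonneg.2 h1) (sub_nonneg.2 ha'.2), mul_nonneg h0 (mul_pos hN' hδ).le]
  have e2 : α * (N * tiltedMean p α - S) ≤ N * δ := by
    nlinarith [mul_nonneg h0 (sub_nonneg.2 ha'.1),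
      mul_nonneg (sub_nonneg.2 h1) (mul_pos hN' hδ).le]
  have e3 := mul_le_mul_of_nonneg_left hα hN'.le
  have e4 := mul_le_mul_of_nonneg_left hα' hN'.le
  refine le_min (Real.exp_le_exp.2 ?_) (Real.exp_le_exp.2 ?_) <;> nlinarith

end Bounds

/-- The Rényi entropy of a family of positive reals. -/
noncomputable def renyiEntropy {ι : Type*} [Fintype ι] (p : ι → ℝ) (α : ℝ) : ℝ :=
  if α = 1 then -∑ i, p i * Real.log (p i) else 1 / (1 - α) * Real.log (rpowSum p α)

/-! ### Continuity of the Rényi entropies -/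

section Calculus
variable {ι : Type*} [Fintype ι] {p : ι → ℝ}

theorem hasDerivAt_rpowSum (hp : ∀ i, 0 < p i) (α : ℝ) :
    HasDerivAt (rpowSum p) (∑ i, p i ^ α * Real.log (p i)) α := by
  refine HasDerivAt.fun_sum fun i _ => ?_
  simpa using (Real.hasStrictDerivAt_const_rpow (hp i) α).hasDerivAt

theorem continuous_rpowSum (hp : ∀ i, 0 < p i) : Continuous (rpowSum p) :=
  continuous_iff_continuousAt.2 fun α => (hasDerivAt_rpowSum hp α).continuousAt

theorem continuous_log_rpowSum [Nonempty ι] (hp : ∀ i, 0 < p i) :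
    Continuous fun α => Real.log (rpowSum p α) :=
  (continuous_rpowSum hp).log fun α => (rpowSum_pos hp α).ne'

theorem rpowSum_one (hp1 : ∑ i, p i = 1) : rpowSum p 1 = 1 := by
  simp [rpowSum, hp1]

/-- Up to sign, the entropy is the difference quotient of `log (rpowSum p α)` based at `1`, and the
Shannon entropy is the derivative that fills in the singularity. -/
theorem continuous_renyiEntropy [Nonempty ι] (hp : ∀ i, 0 < p i) (hp1 : ∑ i, p i = 1) :
    Continuous (renyiEntropy p) := by
  have hd : ∀ α, HasDerivAt (fun α => Real.log (rpowSum p α))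
      ((∑ i, p i ^ α * Real.log (p i)) / rpowSum p α) α := fun α =>
    (hasDerivAt_rpowSum hp α).log (rpowSum_pos hp α).ne'
  have h : renyiEntropy p = fun α => -dslope (fun α => Real.log (rpowSum p α)) 1 α := by
    funext α
    by_cases hα : α = 1
    · subst hα
      simp [renyiEntropy, dslope_same, (hd 1).deriv, rpowSum_one hp1]
    · have h1 : 1 - α ≠ 0 := sub_ne_zero.2 (Ne.symm hα)
      have h2 : α - 1 ≠ 0 := sub_ne_zero.2 hα
      rw [renyiEntropy, if_neg hα, dslope_of_ne _ hα, slope_def_field, rpowSum_one hp1, Real.log_one]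
      field_simp
      ring
  rw [h]
  refine Continuous.neg (continuousOn_univ.1 ((continuousOn_dslope univ_mem).2
    ⟨(continuous_log_rpowSum hp).continuousOn, (hd 1).differentiableAt⟩))

theorem log_rpowSum_eq (hp1 : ∑ i, p i = 1) (α : ℝ) :
    Real.log (rpowSum p α) = (1 - α) * renyiEntropy p α := by
  by_cases hα : α = 1
  · simp [hα, rpowSum_one hp1]
  · have h1 : 1 - α ≠ 0 := sub_ne_zero.2 (Ne.symm hα)
    rw [renyiEntropy, if_neg hα]
    field_simp

theorem continuous_tiltedMean [Nonempty ι] (hp : ∀ i, 0 < p i) : Continuous (tiltedMean p) := by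
  refine Continuous.div (continuous_finsetSum _ fun i _ => ?_) (continuous_rpowSum hp)
    fun α => (rpowSum_pos hp α).ne'
  exact (Real.continuous_const_rpow (hp i).ne').mul continuous_const

theorem tiltedMean_one (hp1 : ∑ i, p i = 1) : tiltedMean p 1 = renyiEntropy p 1 := by
  simp [tiltedMean, renyiEntropy, rpowSum_one hp1]

theorem le_one_of_sum_eq_one (hp : ∀ i, 0 < p i) (hp1 : ∑ i, p i = 1) (i : ι) : p i ≤ 1 :=
  hp1 ▸ Finset.single_le_sum (fun i _ => (hp i).le) (Finset.mem_univ i)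

theorem exists_neg_log_bound (hp : ∀ i, 0 < p i) (hp1 : ∑ i, p i = 1) :
    ∃ B, ∀ i, -Real.log (p i) ∈ Set.Icc 0 B := by
  have h : ∀ i, 0 ≤ -Real.log (p i) := fun i =>
    neg_nonneg.2 (Real.log_nonpos (hp i).le (le_one_of_sum_eq_one hp hp1 i))
  exact ⟨∑ i, -Real.log (p i), fun i =>
    ⟨h i, Finset.single_le_sum (f := fun i => -Real.log (p i)) (fun i _ => h i)
      (Finset.mem_univ i)⟩⟩

end Calculus

/-- For the finitely many small `N`: after scaling by `exp (N * B)` every product is at least `1`,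
so counting terms suffices. -/
theorem sum_min_le_sum_min_exp_mul {ι κ : Type*} [Fintype ι] [Fintype κ] {p : ι → ℝ}
    {q : κ → ℝ} (hp : ∀ i, 0 < p i) {B : ℝ}
    (hB : ∀ i, -Real.log (p i) ∈ Set.Icc 0 B) (hq : ∀ i, 0 < q i) (hq1 : ∑ i, q i = 1)
    {N M : ℕ} (hcard : Fintype.card κ ^ M ≤ Fintype.card ι ^ N) {s : ℝ} (hs : 0 < s) :
    ∑ b : Fin M → κ, min (∏ k, q (b k)) s ≤
      ∑ a : Fin N → ι, min (Real.exp (N * B) * ∏ k, p (a k)) s := by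
  calc _ ≤ ∑ b : Fin M → κ, min 1 s := Finset.sum_le_sum fun b _ => min_le_min_right _
        (Finset.prod_le_one (fun _ _ => (hq _).le) fun _ _ => le_one_of_sum_eq_one hq hq1 _)
    _ = (Fintype.card κ ^ M : ℕ) * min 1 s := by simp
    _ ≤ (Fintype.card ι ^ N : ℕ) * min 1 s := by gcongr
    _ = ∑ a : Fin N → ι, min 1 s := by simp
    _ ≤ _ := Finset.sum_le_sum fun a _ => min_le_min_right _ ?_
  rw [prod_eq_exp_neg hp, ← Real.exp_add, Real.one_le_exp_iff]
  have : ∑ k, -Real.log (p (a k)) ≤ ∑ _k : Fin N, B := Finset.sum_le_sum fun k _ => (hB _).2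
  simp only [Finset.sum_const, Finset.card_univ, Fintype.card_fin, nsmul_eq_mul] at this
  linarith

/-! ### Asymptotic comparison of truncated sums -/

section Comparison
variable {ι κ : Type*} [Fintype ι] [Fintype κ] [Nonempty ι] [Nonempty κ] {p : ι → ℝ} {q : κ → ℝ}

/-- The point is that `c` is uniform in `τ`. In the last inequality, `3 * g` covers the `2 * g` lost
in `le_sum_min_prod` and one further `g` for its Chebyshev prefactor. -/
theorem exists_exponent_gap (hp : ∀ i, 0 < p i) (hp1 : ∑ i, p i = 1) (hq : ∀ i, 0 < q i)
    (hq1 : ∑ i, q i = 1) {r : ℝ}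
    (h : ∀ α ∈ Set.Icc (0 : ℝ) 1, r * renyiEntropy q α < renyiEntropy p α) :
    ∃ δ > 0, ∃ c > 0, ∀ τ, renyiEntropy p 1 - δ ≤ τ → ∃ α ∈ Set.Icc (0 : ℝ) 1,
      ∃ β ∈ Set.Icc (0 : ℝ) 1, ∃ g, c ≤ g ∧ (1 - α) * (tiltedMean p α - τ) ≤ g ∧
        α * (τ - tiltedMean p α) ≤ g ∧
        r * Real.log (rpowSum q β) - (1 - β) * τ + 3 * g ≤
          Real.log (rpowSum p α) - (1 - α) * τ := by
  set h1 := renyiEntropy p 1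
  have hlt := h 1 (by simp)
  set δ := (h1 - r * renyiEntropy q 1) / 3 with hδ
  have hδ0 : 0 < δ := by rw [hδ]; linarith
  -- `β` must be strictly below `1`, so that the factor `1 - β` leaves a positive gap `g₁`.
  obtain ⟨β, hβ, hβ0, hβ1⟩ : ∃ β, r * renyiEntropy q β < h1 - 2 * δ ∧ 0 ≤ β ∧ β < 1 := by
    have e1 : ∀ᶠ β in 𝓝[<] (1 : ℝ), r * renyiEntropy q β < h1 - 2 * δ := by
      refine Filter.Eventually.filter_mono nhdsWithin_le_nhds ?_
      exact ((continuous_const.mul (continuous_renyiEntropy hq hq1)).tendsto 1).eventually_lt_const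
        (show r * renyiEntropy q 1 < h1 - 2 * δ by rw [hδ]; linarith)
    have e2 : ∀ᶠ β in 𝓝[<] (1 : ℝ), β ∈ Set.Ico (0 : ℝ) 1 := Ico_mem_nhdsLT one_pos
    obtain ⟨β, hβ⟩ := (e1.and e2).exists
    exact ⟨β, hβ.1, hβ.2.1, hβ.2.2⟩
  set g₁ := (1 - β) * δ / 3 with hg₁
  have hg₁0 : 0 < g₁ := by have := mul_pos (sub_pos.2 hβ1) hδ0; rw [hg₁]; linarith
  let G : ℝ → ℝ := fun α => Real.log (rpowSum p α) - r * Real.log (rpowSum q α)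
  have hG : Continuous G :=
    (continuous_log_rpowSum hp).sub (continuous_const.mul (continuous_log_rpowSum hq))
  -- These are the tilts needed for `τ > h1 + g₁`. At `α = 1` the tilted mean is `h1`, so `K` misses
  -- the zero of `G` at `1`. The point `0` serves the `τ` beyond `tiltedMean p 0`.
  let K : Set ℝ := Set.Icc 0 1 ∩ ({0} ∪ {α | h1 + g₁ ≤ tiltedMean p α})
  have hK : IsCompact K := isCompact_Icc.inter_right
    (isClosed_singleton.union (isClosed_le continuous_const (continuous_tiltedMean hp)))
  obtain ⟨α₀, hα₀, hmin⟩ := hK.exists_isMinOn ⟨0, by simp [K]⟩ hG.continuousOn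
  have hG0 : 0 < G α₀ := by
    have hne : α₀ ≠ 1 := by
      rintro rfl
      rcases hα₀.2 with h0 | h0
      · simp at h0
      · have : h1 + g₁ ≤ tiltedMean p 1 := h0
        rw [tiltedMean_one hp1] at this
        linarith
    have hα1 : 0 < 1 - α₀ := sub_pos.2 (lt_of_le_of_ne hα₀.1.2 hne)
    have := mul_pos hα1 (sub_pos.2 (h α₀ hα₀.1))
    simp only [G, log_rpowSum_eq hp1, log_rpowSum_eq hq1]
    linarith
  refine ⟨δ, hδ0, min g₁ (G α₀ / 3), lt_min hg₁0 (by linarith), fun τ hτ => ?_⟩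
  have hmem : ∀ α ∈ K, (1 - α) * (tiltedMean p α - τ) ≤ 0 → α * (τ - tiltedMean p α) ≤ 0 →
      ∃ α ∈ Set.Icc (0 : ℝ) 1, ∃ β ∈ Set.Icc (0 : ℝ) 1, ∃ g, min g₁ (G α₀ / 3) ≤ g ∧
        (1 - α) * (tiltedMean p α - τ) ≤ g ∧ α * (τ - tiltedMean p α) ≤ g ∧
        r * Real.log (rpowSum q β) - (1 - β) * τ + 3 * g ≤
          Real.log (rpowSum p α) - (1 - α) * τ := by
    intro α hα e1 e2
    have e3 : G α₀ ≤ G α := hmin hα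
    refine ⟨α, hα.1, α, hα.1, G α₀ / 3, min_le_right _ _, by linarith, by linarith, ?_⟩
    simp only [G] at e3 ⊢
    linarith
  rcases le_or_gt τ (h1 + g₁) with hτ1 | hτ1
  -- At `α = 1` the right-hand side is `0`: the full mass of `p` is used, which allows `τ` to exceed
  -- `h1` by up to `g₁`.
  · refine ⟨1, by simp, β, ⟨hβ0, hβ1.le⟩, g₁, min_le_left _ _, by simpa using hg₁0.le, ?_, ?_⟩
    · rw [tiltedMean_one hp1]; linarith
    · rw [rpowSum_one hp1, log_rpowSum_eq hq1, Real.log_one]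
      have := mul_nonneg (sub_nonneg.2 hβ1.le)
        (show 0 ≤ τ - δ - r * renyiEntropy q β by linarith)
      rw [hg₁]
      nlinarith
  · rcases le_or_gt (tiltedMean p 0) τ with hτ2 | hτ2
    · exact hmem 0 (by simp [K]) (by linarith) (by simp)
    -- The intermediate value theorem supplies a tilt whose mean is exactly `τ`.
    · obtain ⟨α, hα, hατ⟩ := intermediate_value_Icc' zero_le_one
        (continuous_tiltedMean hp).continuousOn
        (show τ ∈ Set.Icc (tiltedMean p 1) (tiltedMean p 0) from
          ⟨by rw [tiltedMean_one hp1]; linarith, hτ2.le⟩)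
      exact hmem α ⟨hα, Or.inr (show h1 + g₁ ≤ tiltedMean p α by linarith)⟩ (by simp [hατ])
        (by simp [hατ])

theorem rpowSum_pow_eq_exp (hq : ∀ i, 0 < q i) (β : ℝ) (M : ℕ) :
    rpowSum q β ^ M = Real.exp (M * Real.log (rpowSum q β)) := by
  rw [Real.exp_nat_mul, Real.exp_log (rpowSum_pos hq β)]

/-- For all but the large thresholds `s`, the truncated mass of the first power is the larger one;
for large `s`, it is almost everything. -/
theorem eventually_sum_min_le (hp : ∀ i, 0 < p i) (hp1 : ∑ i, p i = 1) (hq : ∀ i, 0 < q i)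
    (hq1 : ∑ i, q i = 1) {r : ℝ}
    (h : ∀ α ∈ Set.Icc (0 : ℝ) 1, r * renyiEntropy q α < renyiEntropy p α) :
    ∃ C : ℝ, 0 ≤ C ∧ ∀ᶠ N : ℕ in atTop, ∀ M : ℕ, (M : ℝ) = r * N → ∀ s : ℝ, 0 < s →
      (∑ b : Fin M → κ, min (∏ k, q (b k)) s ≤ ∑ a : Fin N → ι, min (∏ k, p (a k)) s) ∨
        1 - C / N ≤ ∑ a : Fin N → ι, min (∏ k, p (a k)) s := by
  obtain ⟨B, hB⟩ := exists_neg_log_bound hp hp1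
  obtain ⟨δ, hδ, c, hc, hgap⟩ := exists_exponent_gap hp hp1 hq hq1 h
  refine ⟨B ^ 2 / δ ^ 2, by positivity, ?_⟩
  have ev1 : ∀ᶠ N : ℕ in atTop, B ^ 2 / c ^ 2 / N < 1 / 2 :=
    (tendsto_const_div_atTop_nhds_zero_nat _).eventually_lt_const (by norm_num)
  have ev2 : ∀ᶠ N : ℕ in atTop, Real.log 2 ≤ N * c :=
    (tendsto_natCast_atTop_atTop.atTop_mul_const hc).eventually_ge_atTop _
  filter_upwards [ev1, ev2, eventually_gt_atTop 0] with N h1 h2 hN M hM s hs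
  have hN' : (0 : ℝ) < N := by exact_mod_cast hN
  obtain ⟨τ, rfl⟩ : ∃ τ, s = Real.exp (-(N * τ)) :=
    ⟨-Real.log s / N, by field_simp; rw [Real.exp_log hs]⟩
  rcases le_or_gt (renyiEntropy p 1 - δ) τ with hτ | hτ
  · left
    obtain ⟨α, hα, β, hβ, g, hcg, hg1, hg2, hg3⟩ := hgap τ hτ
    have hg0 : 0 < g := hc.trans_le hcg
    have hlow := le_sum_min_prod hp hB hα.1 hα.2 hg0 hg1 hg2 hN
    refine (sum_min_prod_le hq M hs hβ.1 hβ.2).trans (le_trans ?_ hlow)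
    -- The Chebyshev prefactor is at least `1 / 2` for large `N`, which costs one `g` in the
    -- exponent.
    have hhalf : Real.exp (-(N * g)) ≤ 1 - B ^ 2 / (N * g ^ 2) := by
      have e1 : B ^ 2 / (N * g ^ 2) ≤ B ^ 2 / c ^ 2 / N := by
        rw [div_div, mul_comm (c ^ 2)]
        gcongr
      have e2 : Real.exp (-(N * g)) ≤ 1 / 2 := by
        rw [Real.exp_neg, one_div]
        refine inv_anti₀ two_pos ((Real.log_le_iff_le_exp two_pos).1 (h2.trans ?_))
        gcongr
      linarith
    rw [rpowSum_pow_eq_exp hq, rpowSum_pow_eq_exp hp, ← Real.exp_mul, ← Real.exp_add, hM]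
    refine le_trans ?_ (mul_le_mul_of_nonneg_right (mul_le_mul_of_nonneg_right hhalf
      (Real.exp_pos _).le) (Real.exp_pos _).le)
    rw [← Real.exp_add, ← Real.exp_add, Real.exp_le_exp]
    have := mul_le_mul_of_nonneg_left hg3 hN'.le
    nlinarith
  · right
    -- Without tilting, typical products are at most `exp (-N * (h1 - δ))`, with `h1 = renyiEntropy
    -- p 1`, hence below the threshold, and truncation leaves them intact.
    have hlow := one_sub_le_sum_tilted hp hB 1 hδ hN
    rw [rpowSum_one hp1, one_pow, mul_one, tiltedMean_one hp1] at hlow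
    rw [div_div, mul_comm (δ ^ 2)]
    refine hlow.trans ?_
    refine (Finset.sum_le_sum fun a ha => ?_).trans
      (Finset.sum_le_sum_of_subset_of_nonneg (Finset.filter_subset _ _) fun a _ _ =>
        le_min (Finset.prod_nonneg fun _ _ => (hp _).le) hs.le)
    have ha' := abs_le.1 (Finset.mem_filter.1 ha).2
    rw [Real.rpow_one]
    refine le_min le_rfl ?_
    rw [prod_eq_exp_neg hp, Real.exp_le_exp]
    nlinarith

/-- The entropy condition at `α = 0`, where power sums count the terms. -/
theorem card_pow_le_card_pow {r : ℝ}
    (h : r * Real.log (rpowSum q 0) < Real.log (rpowSum p 0)) {N M : ℕ} (hM : (M : ℝ) = r * N) :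
    Fintype.card κ ^ M ≤ Fintype.card ι ^ N := by
  simp only [rpowSum, Real.rpow_zero, Finset.sum_const, Finset.card_univ, nsmul_eq_mul,
    mul_one] at h
  have h1 : (0 : ℝ) < Fintype.card ι := by exact_mod_cast Fintype.card_pos
  have h2 : (0 : ℝ) < Fintype.card κ := by exact_mod_cast Fintype.card_pos
  have : ((Fintype.card κ : ℝ) ^ M) ≤ (Fintype.card ι : ℝ) ^ N := by
    rw [← Real.log_le_log_iff (by positivity) (by positivity), Real.log_pow, Real.log_pow, hM]
    nlinarith [mul_le_mul_of_nonneg_left h.le N.cast_nonneg]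
  exact_mod_cast this

/-- If the Rényi entropies of `p` of all orders in `[0, 1]` exceed `r` times those of `q`, then large
powers of `p`, scaled by a factor that tends to `1`, dominate `r` times as large powers of `q`. -/
theorem exists_tendsto_sum_min_le (hp : ∀ i, 0 < p i) (hp1 : ∑ i, p i = 1) (hq : ∀ i, 0 < q i)
    (hq1 : ∑ i, q i = 1) {r : ℝ}
    (h : ∀ α ∈ Set.Icc (0 : ℝ) 1, r * renyiEntropy q α < renyiEntropy p α) :
    ∃ x : ℕ → ℝ, (∀ n, 1 ≤ x n) ∧ Tendsto x atTop (𝓝 1) ∧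
      ∀ N M : ℕ, (M : ℝ) = r * N → ∀ t : ℝ, 0 < t →
        ∑ b : Fin M → κ, min (∏ k, q (b k)) t ≤
          ∑ a : Fin N → ι, min (x N * ∏ k, p (a k)) t := by
  obtain ⟨B, hB⟩ := exists_neg_log_bound hp hp1
  obtain ⟨C, hC, hev⟩ := eventually_sum_min_le hp hp1 hq hq1 h
  have hlim : Tendsto (fun N : ℕ => C / N) atTop (𝓝 0) := tendsto_const_div_atTop_nhds_zero_nat _
  obtain ⟨N₀, hN₀⟩ := eventually_atTop.1 (hev.and (hlim.eventually_lt_const one_pos))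
  have hB0 : 0 ≤ B := (hB (Classical.arbitrary ι)).1.trans (hB (Classical.arbitrary ι)).2
  -- For large `N`, the inverse of the mass guaranteed after truncation; otherwise the crude factor
  -- of `sum_min_le_sum_min_exp_mul`, which does not affect the limit.
  refine ⟨fun N => if N₀ ≤ N then (1 - C / N)⁻¹ else Real.exp (N * B), fun N => ?_, ?_, ?_⟩
  · dsimp only
    split_ifs with hN
    · exact one_le_inv_iff₀.2 ⟨by linarith [(hN₀ N hN).2], by
        have : 0 ≤ C / N := by positivity
        linarith⟩
    · exact Real.one_le_exp (by positivity)
  · have : Tendsto (fun N : ℕ => (1 - C / N)⁻¹) atTop (𝓝 1) := by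
      simpa using (tendsto_const_nhds.sub hlim).inv₀ (by norm_num : (1 : ℝ) - 0 ≠ 0)
    refine this.congr' ?_
    filter_upwards [eventually_ge_atTop N₀] with N hN
    rw [if_pos hN]
  · intro N M hM t ht
    dsimp only
    split_ifs with hN
    · have hlt := (hN₀ N hN).2
      have hle : 0 ≤ C / N := by positivity
      set y := 1 - C / (N : ℝ)
      have hy : 0 < y := by simp only [y]; linarith
      have hy1 : y ≤ 1 := by simp only [y]; linarith
      have hscale : ∑ a : Fin N → ι, min (y⁻¹ * ∏ k, p (a k)) t =
          y⁻¹ * ∑ a : Fin N → ι, min (∏ k, p (a k)) (y * t) := by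
        rw [Finset.mul_sum]
        refine Finset.sum_congr rfl fun a _ => ?_
        rw [mul_min_of_nonneg _ _ (inv_pos.2 hy).le, inv_mul_cancel_left₀ hy.ne']
      rw [hscale, ← div_eq_inv_mul, le_div_iff₀ hy]
      rcases (hN₀ N hN).1 M hM (y * t) (mul_pos hy ht) with h1 | h1
      · refine le_trans ?_ h1
        rw [Finset.sum_mul]
        refine Finset.sum_le_sum fun b _ => ?_
        rw [mul_comm, mul_min_of_nonneg _ _ hy.le]
        exact min_le_min_right _ (mul_le_of_le_one_left
          (Finset.prod_nonneg fun _ _ => (hq _).le) hy1)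
      · refine le_trans ?_ h1
        refine mul_le_of_le_one_left hy.le ?_
        calc _ ≤ ∑ b : Fin M → κ, ∏ k, q (b k) := Finset.sum_le_sum fun b _ => min_le_left _ _
          _ = 1 := by rw [sum_prod_pi, hq1, one_pow]
    · refine sum_min_le_sum_min_exp_mul hp hB hq hq1 (card_pow_le_card_pow (p := p) (q := q) ?_ hM) ht
      have := h 0 (by simp)
      simpa [log_rpowSum_eq hp1, log_rpowSum_eq hq1] using this

end Comparison

/-! ### Majorization and convex combinations of permutations -/

section Majorization
variable {ι κ : Type*} [Fintype ι] [Fintype κ]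

/-- A nonnegative function is a positive combination of indicators of its superlevel sets. -/
theorem sum_mul_nonneg_of_superlevel (y w : ι → ℝ) (hw : ∀ i, 0 ≤ w i)
    (h : ∀ s, 0 ≤ s → 0 ≤ ∑ i with s < w i, y i) : 0 ≤ ∑ i, w i * y i := by
  induction hn : (Finset.univ.filter fun i => 0 < w i).card using Nat.strong_induction_on
    generalizing w with
  | _ n ih =>
    set T := Finset.univ.filter fun i => 0 < w i with hT
    rcases T.eq_empty_or_nonempty with hTe | hTne
    · have : ∀ i, w i = 0 := fun i => le_antisymm (not_lt.1 fun hi => by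
        have : i ∈ T := by simp [hT, hi]
        simp [hTe] at this) (hw i)
      simp [this]
    · obtain ⟨i₀, hi₀, hmin⟩ := T.exists_min_image w hTne
      have hm : 0 < w i₀ := by simpa [hT] using hi₀
      -- Lowering the positive weights by the smallest one removes `i₀` from the support, and the
      -- superlevel sets of `w'` are again superlevel sets of `w`.
      let w' : ι → ℝ := fun i => if 0 < w i then w i - w i₀ else 0
      have hw'0 : ∀ i, 0 ≤ w' i := fun i => by
        by_cases hi : 0 < w i
        · simpa [w', hi] using hmin i (by simp [hT, hi])
        · simp [w', hi]
      have hlev : ∀ s, 0 ≤ s → ∀ i, s < w' i ↔ s + w i₀ < w i := fun s hs i => by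
        by_cases hi : 0 < w i
        · simp only [w', hi, if_true]; constructor <;> intro <;> linarith
        · simp only [w', hi, if_false]; constructor <;> intro <;> linarith
      have hcard : (Finset.univ.filter fun i => 0 < w' i).card < n := by
        rw [← hn]
        refine Finset.card_lt_card (Finset.ssubset_iff_of_subset (fun i hi => ?_) |>.2
          ⟨i₀, hi₀, by simp [w']⟩)
        have := (hlev 0 le_rfl i).1 (Finset.mem_filter.1 hi).2
        simp only [hT, Finset.mem_filter, Finset.mem_univ, true_and]
        linarith
      have h1 := ih _ hcard w' hw'0 (fun s hs => by
        simp only [hlev s hs]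
        exact h _ (by linarith)) rfl
      have h2 := mul_nonneg hm.le (h 0 le_rfl)
      have h3 : ∑ i, w i * y i = w i₀ * (∑ i with 0 < w i, y i) + ∑ i, w' i * y i := by
        rw [Finset.sum_filter, Finset.mul_sum, ← Finset.sum_add_distrib]
        refine Finset.sum_congr rfl fun i _ => ?_
        by_cases hi : 0 < w i
        · simp only [w', hi, if_true]; ring
        · simp [w', le_antisymm (not_lt.1 hi) (hw i)]
      linarith

/-- Sort both functions and match their ranks in reverse. By the rearrangement inequality such a `σ`
minimizes `∑ w i * u (σ i)`, so it is the permutation to test against a separating functional. -/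
theorem exists_perm_antivary (u w : ι → ℝ) : ∃ σ : Equiv.Perm ι, Antivary (u ∘ σ) w := by
  let e := (Fintype.equivFin ι).symm
  let s₁ := Tuple.sort (w ∘ e)
  let s₂ := Tuple.sort (u ∘ e)
  have h₁ : Monotone ((w ∘ e) ∘ s₁) := Tuple.monotone_sort _
  have h₂ : Monotone ((u ∘ e) ∘ s₂) := Tuple.monotone_sort _
  refine ⟨((e.symm.trans s₁.symm).trans Fin.revPerm).trans (s₂.trans e), fun i j hij => ?_⟩
  have hlt : s₁.symm (e.symm i) < s₁.symm (e.symm j) := by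
    by_contra hle
    have := h₁ (not_lt.1 hle)
    simp only [Function.comp_apply, Equiv.apply_symm_apply] at this
    linarith
  exact h₂ (Fin.rev_le_rev.2 hlt.le)

/-- If `u` is smaller on `S` than outside of `S`, then domination of the truncated sums implies
domination of the sums over `S`. -/
theorem sum_le_sum_of_sum_min_le {u v : ι → ℝ} (hv : ∀ i, 0 ≤ v i)
    (h : ∀ t, 0 < t → ∑ i, min (u i) t ≤ ∑ i, min (v i) t) (S : Finset ι)
    (hS : ∀ a ∈ S, ∀ b ∉ S, u a ≤ u b) : ∑ i ∈ S, u i ≤ ∑ i ∈ S, v i := by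
  classical
  rcases S.eq_empty_or_nonempty with rfl | hne
  · simp
  obtain ⟨a, ha, hmax⟩ := S.exists_max_image u hne
  rcases le_or_gt (u a) 0 with h0 | h0
  · exact Finset.sum_le_sum fun i hi => ((hmax i hi).trans h0).trans (hv i)
  -- Truncating at the maximum of `u` on `S` keeps `u` on `S` and makes it constant outside, where
  -- `v` cannot do better.
  have h1 := h (u a) h0
  rw [← Finset.sum_add_sum_compl S, ← Finset.sum_add_sum_compl S (fun i => min (v i) (u a))] at h1
  have h2 : ∑ i ∈ S, min (u i) (u a) = ∑ i ∈ S, u i :=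
    Finset.sum_congr rfl fun i hi => min_eq_left (hmax i hi)
  have h3 : ∑ i ∈ Sᶜ, min (u i) (u a) = ∑ i ∈ Sᶜ, u a :=
    Finset.sum_congr rfl fun i hi => min_eq_right (hS a ha i (Finset.mem_compl.1 hi))
  have h4 : ∑ i ∈ S, min (v i) (u a) ≤ ∑ i ∈ S, v i := Finset.sum_le_sum fun i _ => min_le_left _ _
  have h5 : ∑ i ∈ Sᶜ, min (v i) (u a) ≤ ∑ i ∈ Sᶜ, u a :=
    Finset.sum_le_sum fun i _ => min_le_right _ _
  linarith

/-- A form of the theorem of Hardy, Littlewood and Pólya. -/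
theorem exists_weights_perm [DecidableEq ι] {u v : ι → ℝ} (hv : ∀ i, 0 ≤ v i)
    (h : ∀ t, 0 < t → ∑ i, min (u i) t ≤ ∑ i, min (v i) t) :
    ∃ c : Equiv.Perm ι → ℝ, (∀ σ, 0 ≤ c σ) ∧ ∑ σ, c σ = 1 ∧ ∀ a, ∑ σ, c σ * u (σ a) ≤ v a := by
  let T : (Equiv.Perm ι → ℝ) →ₗ[ℝ] (ι → ℝ) :=
    { toFun := fun c a => ∑ σ, c σ * u (σ a)
      map_add' := fun c d => by ext a; simp [add_mul, Finset.sum_add_distrib]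
      map_smul' := fun r c => by ext a; simp [Finset.mul_sum, mul_assoc] }
  by_contra hcon
  have hdisj : Disjoint (T '' stdSimplex ℝ (Equiv.Perm ι)) (Set.Iic v) := by
    rw [Set.disjoint_left]
    rintro _ ⟨c, hc, rfl⟩ hle
    exact hcon ⟨c, hc.1, hc.2, hle⟩
  -- If no weights work, a functional separates the convex hull of the rearrangements of `u` from
  -- the vectors below `v`.
  obtain ⟨F, x, y, hF1, hxy, hF2⟩ := geometric_hahn_banach_compact_closed
    ((convex_stdSimplex ℝ (Equiv.Perm ι)).linear_image T)
    ((isCompact_stdSimplex ℝ (Equiv.Perm ι)).image T.continuous_of_finiteDimensional)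
    (convex_Iic v) isClosed_Iic hdisj
  have hFsum : ∀ z : ι → ℝ, F z = ∑ i, z i * F (Pi.single i 1) := fun z => by
    conv_lhs => rw [pi_eq_sum_univ' z]
    simp [map_sum, Pi.single]
  -- `F` is bounded below on a set that extends to `-∞` in every coordinate direction; for a
  -- positive value, the chosen shift would bring `F` down to exactly `y`.
  have hneg : ∀ i, F (Pi.single i 1) ≤ 0 := fun i => by
    by_contra hpos
    rw [not_le] at hpos
    have hv' := hF2 v Set.self_mem_Iic
    have := hF2 (v - ((F v - y) / F (Pi.single i 1)) • Pi.single i 1) (by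
      refine Set.mem_Iic.2 (sub_le_self _ (smul_nonneg (div_nonneg (by linarith) hpos.le) ?_))
      exact Pi.single_nonneg.2 zero_le_one)
    rw [map_sub, map_smul, smul_eq_mul, div_mul_cancel₀ _ hpos.ne'] at this
    linarith
  let w : ι → ℝ := fun i => -F (Pi.single i 1)
  obtain ⟨σ, hσ⟩ := exists_perm_antivary u w
  have key : 0 ≤ ∑ i, w i * (v i - u (σ i)) := by
    refine sum_mul_nonneg_of_superlevel _ w (fun i => neg_nonneg.2 (hneg i)) fun s _ => ?_
    rw [Finset.sum_sub_distrib, sub_nonneg]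
    refine sum_le_sum_of_sum_min_le (u := fun i => u (σ i)) hv (fun t ht => ?_) _
      fun a ha b hb => ?_
    · rw [Equiv.sum_comp σ fun i => min (u i) t]
      exact h t ht
    · simp only [Finset.mem_filter, Finset.mem_univ, true_and, not_lt] at ha hb
      exact hσ (hb.trans_lt ha)
  have h1 : F (T (Pi.single σ 1)) < x := hF1 _ ⟨_, single_mem_stdSimplex ℝ σ, rfl⟩
  have h2 : T (Pi.single σ 1) = fun i => u (σ i) := by
    ext a
    simp [T, Pi.single_apply]
  have h3 := hF2 v Set.self_mem_Iic
  rw [h2, hFsum] at h1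
  rw [hFsum] at h3
  simp only [w, mul_sub, neg_mul, Finset.sum_sub_distrib, Finset.sum_neg_distrib] at key
  simp only [mul_comm (F _)] at key
  linarith

/-- Take the least value of `u` as the threshold: all terms on the left equal it. -/
theorem card_le_card_of_sum_min_le {u : κ → ℝ} {v : ι → ℝ} (hu : ∀ i, 0 < u i)
    (h : ∀ t, 0 < t → ∑ i, min (u i) t ≤ ∑ i, min (v i) t) :
    Fintype.card κ ≤ Fintype.card ι := by
  rcases isEmpty_or_nonempty κ with hκ | hκ
  · simp
  obtain ⟨i₀, -, hmin⟩ := Finset.univ.exists_min_image u Finset.univ_nonempty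
  have h1 : ∑ i : κ, u i₀ ≤ ∑ a : ι, u i₀ := by
    calc ∑ i : κ, u i₀ = ∑ i, min (u i) (u i₀) :=
          Finset.sum_congr rfl fun i hi => (min_eq_right (hmin i hi)).symm
      _ ≤ ∑ a, min (v a) (u i₀) := h _ (hu i₀)
      _ ≤ _ := Finset.sum_le_sum fun a _ => min_le_right _ _
  simp only [Finset.sum_const, Finset.card_univ, nsmul_eq_mul] at h1
  exact_mod_cast le_of_mul_le_mul_right h1 (hu i₀)

/-- Pad `u` with zeros along an embedding `e₀`. A permutation `σ` of the padded family then becomes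
the embedding `σ⁻¹ ∘ e₀`. -/
theorem exists_weights_embedding [DecidableEq ι] {u : κ → ℝ} {v : ι → ℝ} (hu : ∀ i, 0 < u i)
    (hv : ∀ i, 0 ≤ v i) (h : ∀ t, 0 < t → ∑ i, min (u i) t ≤ ∑ i, min (v i) t) :
    ∃ (c : Equiv.Perm ι → ℝ) (e : Equiv.Perm ι → κ ↪ ι), (∀ σ, 0 ≤ c σ) ∧ ∑ σ, c σ = 1 ∧
      ∀ a, ∑ σ, c σ * ∑ i with e σ i = a, u i ≤ v a := by
  obtain ⟨e₀⟩ := Function.Embedding.nonempty_of_card_le (card_le_card_of_sum_min_le hu h)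
  let u' : ι → ℝ := Function.extend e₀ u 0
  obtain ⟨c, hc0, hc1, hc⟩ := exists_weights_perm (u := u') hv fun t ht => by
    refine le_trans (le_of_eq ?_) (h t ht)
    refine (Fintype.sum_of_injective e₀ e₀.injective _ _ (fun a ha => ?_) fun i => ?_).symm
    · simp only [u']
      rw [Function.extend_apply' _ _ _ ha]
      exact min_eq_left ht.le
    · simp only [u', e₀.injective.extend_apply]
  refine ⟨c, fun σ => e₀.trans σ.symm.toEmbedding, hc0, hc1, fun a => ?_⟩
  refine le_trans (le_of_eq (Finset.sum_congr rfl fun σ _ => ?_)) (hc a)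
  congr 1
  by_cases ha : ∃ i, e₀ i = σ a
  · obtain ⟨i, hi⟩ := ha
    rw [← hi]
    simp only [u', e₀.injective.extend_apply]
    have : (Finset.univ.filter fun j => (e₀.trans σ.symm.toEmbedding) j = a) = {i} := by
      ext j
      simp [Equiv.symm_apply_eq, ← hi]
    rw [this, Finset.sum_singleton]
  · simp only [u']
    rw [Function.extend_apply' _ _ _ ha]
    refine Finset.sum_eq_zero fun j hj => (ha ⟨j, ?_⟩).elim
    simpa [Equiv.symm_apply_eq] using hj

end Majorization

/-! ### Conversion by one-way LOCC -/

section Channels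

/-- The matrix of coefficients of a bipartite vector. -/
def coeffMatrix {A B : Type} (ψ : A × B → ℂ) : Matrix A B ℂ := Matrix.of fun a b => ψ (a, b)

theorem mul_pureState_mul {A B A' B' : Type} [Fintype A] [Fintype B]
    (M : Matrix (A' × B') (A × B) ℂ) (ψ : A × B → ℂ) :
    M * pureState ψ * Mᴴ = pureState (M *ᵥ ψ) := by
  rw [pureState, pureState, Matrix.mul_vecMulVec, Matrix.vecMulVec_mul, Matrix.star_mulVec]

theorem coeffMatrix_first {A A' B : Type} [Fintype A] [Fintype B] [DecidableEq B]
    (K : Matrix A' A ℂ) (ψ : A × B → ℂ) :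
    coeffMatrix ((K ⊗ₖ (1 : Matrix B B ℂ)) *ᵥ ψ) = K * coeffMatrix ψ := by
  ext a b
  simp [coeffMatrix, Matrix.mulVec, dotProduct, Matrix.mul_apply, Fintype.sum_prod_type,
    Matrix.one_apply]

theorem coeffMatrix_second {A B B' : Type} [Fintype A] [Fintype B] [DecidableEq A]
    (L : Matrix B' B ℂ) (ψ : A × B → ℂ) :
    coeffMatrix (((1 : Matrix A A ℂ) ⊗ₖ L) *ᵥ ψ) = coeffMatrix ψ * Lᵀ := by
  ext a b
  simp [coeffMatrix, Matrix.mulVec, dotProduct, Matrix.mul_apply, Fintype.sum_prod_type_right,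
    Matrix.one_apply, mul_comm]

/-- The matrix that maps the basis vector `e i` to a multiple of the basis vector `i`. -/
def transferMatrix {ι κ : Type} [DecidableEq ι] (e : κ ↪ ι) (x : κ → ℝ) : Matrix κ ι ℂ :=
  Matrix.of fun i a => if e i = a then ((x i : ℝ) : ℂ) else 0

theorem transferMatrix_conjTranspose_mul_self {ι κ : Type} [Fintype κ] [DecidableEq ι]
    (e : κ ↪ ι) (x : κ → ℝ) :
    (transferMatrix e x)ᴴ * transferMatrix e x =
      Matrix.diagonal fun a => ((∑ i with e i = a, x i ^ 2 : ℝ) : ℂ) := by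
  ext a b
  simp only [transferMatrix, Matrix.mul_apply, Matrix.conjTranspose_apply, Matrix.of_apply,
    Matrix.diagonal_apply]
  split_ifs with hab
  · subst hab
    rw [Finset.sum_filter, Complex.ofReal_sum]
    refine Finset.sum_congr rfl fun i _ => ?_
    split_ifs <;> simp [sq]
  · refine Finset.sum_eq_zero fun i _ => ?_
    by_cases h : e i = a
    · rw [if_neg (fun h' => hab (h.symm.trans h')), mul_zero]
    · simp [h]

theorem transferMatrix_mul_diagonal_mul_transpose {ι κ : Type} [Fintype ι] [DecidableEq ι]
    [DecidableEq κ] (e : κ ↪ ι) (x y : κ → ℝ) (d : ι → ℝ) :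
    transferMatrix e x * Matrix.diagonal (fun a => ((d a : ℝ) : ℂ)) * (transferMatrix e y)ᵀ =
      Matrix.diagonal fun i => ((x i * d (e i) * y i : ℝ) : ℂ) := by
  ext i j
  rw [Matrix.mul_apply]
  simp only [Matrix.mul_diagonal, transferMatrix, Matrix.transpose_apply, Matrix.of_apply,
    Matrix.diagonal_apply, ite_mul, zero_mul, Finset.sum_ite_eq, Finset.mem_univ, if_true]
  by_cases h : i = j
  · subst h; simp
  · simp [h, Ne.symm h]

theorem isometry_sandwich {A A' ι κ : Type} [Fintype A'] [Fintype ι] [Fintype κ]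
    [DecidableEq κ] {U : Matrix A ι ℂ} {U' : Matrix A' κ ℂ} (hU' : U'ᴴ * U' = 1)
    (E : Matrix κ ι ℂ) : (U' * E * Uᴴ)ᴴ * (U' * E * Uᴴ) = U * (Eᴴ * E) * Uᴴ := by
  rw [Matrix.conjTranspose_mul, Matrix.conjTranspose_mul, Matrix.conjTranspose_conjTranspose]
  calc _ = U * (Eᴴ * (U'ᴴ * U') * E) * Uᴴ := by simp only [Matrix.mul_assoc]
    _ = _ := by rw [hU', Matrix.mul_one]

variable {A B A' B' : Type} [Fintype A] [Fintype B] [Fintype A'] [Fintype B']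
  [DecidableEq A] [DecidableEq B] [DecidableEq A'] [DecidableEq B']

/-- One-way LOCC: the first party measures, and the second party corrects. -/
theorem converts_of_kraus {J : Type} [Fintype J] [DecidableEq J] {ψ : A × B → ℂ}
    {φ : A' × B' → ℂ} (K : J → Matrix A' A ℂ) (L : J → Matrix B' B ℂ) (c : J → ℝ)
    (hc0 : ∀ j, 0 ≤ c j) (hc1 : ∑ j, c j = 1) (hK : (1 - ∑ j, (K j)ᴴ * K j).PosSemidef)
    (hL : ∀ j, (1 - (L j)ᴴ * L j).PosSemidef)
    (h : ∀ j, K j * coeffMatrix ψ * (L j)ᵀ = ((Real.sqrt (c j) : ℝ) : ℂ) • coeffMatrix φ) :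
    Converts ψ φ := by
  refine ⟨_, .comp (.oneStep (.first (Y := J) K (fun _ => ()) id fun x => ?_))
    (.second L id (fun _ => ()) fun j => ?_), ?_⟩
  · simpa using hK
  · simpa [Finset.filter_eq'] using hL j
  · funext y
    have key : ∀ j, ((1 : Matrix A' A' ℂ) ⊗ₖ L j) * ((K j ⊗ₖ (1 : Matrix B B ℂ)) * pureState ψ *
        (K j ⊗ₖ (1 : Matrix B B ℂ))ᴴ) * ((1 : Matrix A' A' ℂ) ⊗ₖ L j)ᴴ =
        ((c j : ℝ) : ℂ) • pureState φ := by
      intro j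
      rw [mul_pureState_mul, mul_pureState_mul]
      have e : ((1 : Matrix A' A' ℂ) ⊗ₖ L j) *ᵥ ((K j ⊗ₖ (1 : Matrix B B ℂ)) *ᵥ ψ) =
          ((Real.sqrt (c j) : ℝ) : ℂ) • φ := by
        funext p
        have := congrFun (congrFun (h j) p.1) p.2
        rwa [← coeffMatrix_first, ← coeffMatrix_second] at this
      rw [e, pureState, pureState, star_smul, Matrix.smul_vecMulVec, Matrix.vecMulVec_smul,
        smul_smul]
      congr 1
      rw [RCLike.star_def, Complex.conj_ofReal, ← Complex.ofReal_mul, Real.mul_self_sqrt (hc0 j)]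
    simp only [Function.comp_apply, id_eq, Finset.filter_eq', Finset.mem_univ, if_true,
      Finset.sum_singleton, key, Finset.filter_true]
    rw [← Finset.sum_smul, ← Complex.ofReal_sum, hc1, Complex.ofReal_one, one_smul]

variable {ι κ : Type} [Fintype ι] [Fintype κ] [DecidableEq ι] [DecidableEq κ]

/-- `v` is the family of Schmidt coefficients (squared) of `ψ`. -/
def HasSchmidt (ψ : A × B → ℂ) (v : ι → ℝ) : Prop :=
  (∀ k, 0 < v k) ∧ ∃ (U : Matrix A ι ℂ) (W : Matrix B ι ℂ), Uᴴ * U = 1 ∧ Wᴴ * W = 1 ∧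
    coeffMatrix ψ = U * Matrix.diagonal (fun k => ((Real.sqrt (v k) : ℝ) : ℂ)) * Wᵀ

/-- Split off the projection `1 - U * Uᴴ` onto the complement of the range; the rest is `U * (1 - D)
* Uᴴ`. -/
theorem posSemidef_one_sub_of_isometry {U : Matrix A ι ℂ} (hU : Uᴴ * U = 1) {D : ι → ℝ}
    (hD : ∀ k, D k ≤ 1) :
    (1 - U * Matrix.diagonal (fun k => ((D k : ℝ) : ℂ)) * Uᴴ).PosSemidef := by
  have h1 : (1 - U * Uᴴ).PosSemidef := by
    have hP : U * Uᴴ * (U * Uᴴ) = U * Uᴴ := by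
      rw [Matrix.mul_assoc, ← Matrix.mul_assoc Uᴴ, hU, Matrix.one_mul]
    have : 1 - U * Uᴴ = (1 - U * Uᴴ)ᴴ * (1 - U * Uᴴ) := by
      rw [Matrix.conjTranspose_sub, Matrix.conjTranspose_one, Matrix.conjTranspose_mul,
        Matrix.conjTranspose_conjTranspose, Matrix.sub_mul, Matrix.mul_sub, Matrix.mul_sub, hP]
      simp
    rw [this]
    exact Matrix.posSemidef_conjTranspose_mul_self _
  have h2 : (U * Matrix.diagonal (fun k => ((1 - D k : ℝ) : ℂ)) * Uᴴ).PosSemidef := by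
    refine (Matrix.posSemidef_diagonal_iff.2 fun k => ?_).mul_mul_conjTranspose_same U
    exact_mod_cast sub_nonneg.2 (hD k)
  have h3 : 1 - U * Matrix.diagonal (fun k => ((D k : ℝ) : ℂ)) * Uᴴ =
      (1 - U * Uᴴ) + U * Matrix.diagonal (fun k => ((1 - D k : ℝ) : ℂ)) * Uᴴ := by
    have : Matrix.diagonal (fun k => ((1 - D k : ℝ) : ℂ)) =
        (1 : Matrix ι ι ℂ) - Matrix.diagonal (fun k => ((D k : ℝ) : ℂ)) := by
      rw [← Matrix.diagonal_one, Matrix.diagonal_sub]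
      simp
    rw [this, Matrix.mul_sub, Matrix.sub_mul, Matrix.mul_one]
    abel
  rw [h3]
  exact h1.add h2

/-- Vidal's theorem, the sufficiency of domination of the truncated sums. -/
theorem converts_of_hasSchmidt {ψ : A × B → ℂ} {φ : A' × B' → ℂ} {v : ι → ℝ} {u : κ → ℝ}
    (hψ : HasSchmidt ψ v) (hφ : HasSchmidt φ u)
    (h : ∀ t, 0 < t → ∑ i, min (u i) t ≤ ∑ i, min (v i) t) : Converts ψ φ := by
  obtain ⟨hv, U, W, hU, hW, hψ⟩ := hψ
  obtain ⟨hu, U', W', hU', hW', hφ⟩ := hφ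
  obtain ⟨c, e, hc0, hc1, hc⟩ := exists_weights_embedding hu (fun a => (hv a).le) h
  have hx0 : ∀ σ i, 0 ≤ c σ * u i / v (e σ i) := fun σ i =>
    div_nonneg (mul_nonneg (hc0 σ) (hu i).le) (hv _).le
  -- Outcome `σ` rescales the Schmidt coefficient `√(v (e σ i))` to `√(c σ * u i)`, leaving `√(c σ)`
  -- times the target; the second party applies a partial isometry. The majorization weights bound
  -- the sum of the `Kᴴ * K`.
  refine converts_of_kraus
    (fun σ => U' * transferMatrix (e σ) (fun i => Real.sqrt (c σ * u i / v (e σ i))) * Uᴴ)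
    (fun σ => W' * transferMatrix (e σ) (fun _ => 1) * Wᴴ) c hc0 hc1 ?_ (fun σ => ?_) fun σ => ?_
  · simp only [isometry_sandwich hU', transferMatrix_conjTranspose_mul_self, ← Matrix.sum_mul,
      ← Matrix.mul_sum]
    have : ∑ σ, Matrix.diagonal (fun a =>
        ((∑ i with e σ i = a, Real.sqrt (c σ * u i / v (e σ i)) ^ 2 : ℝ) : ℂ)) =
        Matrix.diagonal fun a => ((∑ σ, (c σ * ∑ i with e σ i = a, u i) / v a : ℝ) : ℂ) := by
      ext a b
      rw [Matrix.sum_apply]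
      simp only [Matrix.diagonal_apply]
      split_ifs with hab
      · rw [← Complex.ofReal_sum]
        congr 1
        refine Finset.sum_congr rfl fun σ _ => ?_
        rw [Finset.mul_sum, Finset.sum_div]
        refine Finset.sum_congr rfl fun i hi => ?_
        rw [Real.sq_sqrt (hx0 σ i), (Finset.mem_filter.1 hi).2]
      · simp
    rw [this]
    refine posSemidef_one_sub_of_isometry hU fun a => ?_
    rw [← Finset.sum_div]
    exact (div_le_one (hv a)).2 (hc a)
  · rw [isometry_sandwich hW', transferMatrix_conjTranspose_mul_self]
    refine posSemidef_one_sub_of_isometry hW fun a => ?_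
    simp only [one_pow, Finset.sum_const, nsmul_eq_mul, mul_one]
    have : (Finset.univ.filter fun i => e σ i = a).card ≤ 1 :=
      Finset.card_le_one.2 fun i hi j hj => (e σ).injective
        ((Finset.mem_filter.1 hi).2.trans (Finset.mem_filter.1 hj).2.symm)
    exact_mod_cast this
  · have hW2 : Wᵀ * (Wᴴ)ᵀ = 1 := by rw [← Matrix.transpose_mul, hW, Matrix.transpose_one]
    rw [hψ, hφ, Matrix.transpose_mul, Matrix.transpose_mul]
    calc _ = U' * (transferMatrix (e σ) (fun i => Real.sqrt (c σ * u i / v (e σ i))) * (Uᴴ * U) *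
            Matrix.diagonal (fun k => ((Real.sqrt (v k) : ℝ) : ℂ)) * (Wᵀ * (Wᴴ)ᵀ) *
            (transferMatrix (e σ) (fun _ => 1))ᵀ) * W'ᵀ := by simp only [Matrix.mul_assoc]
      _ = U' * (((Real.sqrt (c σ) : ℝ) : ℂ) •
            Matrix.diagonal (fun k => ((Real.sqrt (u k) : ℝ) : ℂ))) * W'ᵀ := by
          rw [hU, hW2, Matrix.mul_one, Matrix.mul_one, transferMatrix_mul_diagonal_mul_transpose,
            ← Matrix.diagonal_smul]
          congr 3
          funext i
          rw [mul_one, ← Real.sqrt_mul (hx0 σ i), div_mul_cancel₀ _ (hv _).ne',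
            Real.sqrt_mul (hc0 σ)]
          simp
      _ = _ := by rw [Matrix.mul_smul, Matrix.smul_mul]

end Channels

/-! ### Schmidt coefficients of multiples and tensor powers -/

section Schmidt
variable {A B : Type} {ι : Type} [DecidableEq ι]

theorem HasSchmidt.smul [Fintype A] [Fintype B] [Fintype ι] {ψ : A × B → ℂ} {v : ι → ℝ}
    (h : HasSchmidt ψ v) {x : ℝ} (hx : 0 < x) :
    HasSchmidt (((Real.sqrt x : ℝ) : ℂ) • ψ) (fun k => x * v k) := by
  obtain ⟨hv, U, W, hU, hW, hψ⟩ := h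
  refine ⟨fun k => mul_pos hx (hv k), U, W, hU, hW, ?_⟩
  have : coeffMatrix (((Real.sqrt x : ℝ) : ℂ) • ψ) = ((Real.sqrt x : ℝ) : ℂ) • coeffMatrix ψ := rfl
  rw [this, hψ, ← Matrix.smul_mul, ← Matrix.mul_smul, ← Matrix.diagonal_smul]
  congr 3
  funext k
  simp [Real.sqrt_mul hx.le]

/-- The `n`-th tensor power of a matrix. -/
def matrixPow (n : ℕ) (U : Matrix A ι ℂ) : Matrix (Fin n → A) (Fin n → ι) ℂ :=
  Matrix.of fun a k => ∏ i, U (a i) (k i)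

theorem matrixPow_conjTranspose_mul_self [Fintype A] (n : ℕ) {U : Matrix A ι ℂ}
    (hU : Uᴴ * U = 1) : (matrixPow n U)ᴴ * matrixPow n U = 1 := by
  classical
  ext k l
  have h : ∀ i j, ∑ a, star (U a i) * U a j = if i = j then 1 else 0 := fun i j => by
    have := congrFun (congrFun hU i) j
    rwa [Matrix.mul_apply, Matrix.one_apply] at this
  simp only [matrixPow, Matrix.mul_apply, Matrix.conjTranspose_apply, Matrix.of_apply, star_prod,
    ← Finset.prod_mul_distrib]
  have := Finset.prod_univ_sum (fun _ : Fin n => (Finset.univ : Finset A))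
    fun i a => star (U a (k i)) * U a (l i)
  rw [Fintype.piFinset_univ] at this
  rw [← this, Matrix.one_apply]
  simp only [h, Finset.prod_ite_zero, Finset.prod_const_one, Finset.mem_univ, true_implies,
    funext_iff]

theorem HasSchmidt.tensorPow [Fintype A] [Fintype B] [Fintype ι] {ψ : A × B → ℂ} {v : ι → ℝ}
    (h : HasSchmidt ψ v) (n : ℕ) :
    HasSchmidt (tensorPow n ψ) (fun k : Fin n → ι => ∏ i, v (k i)) := by
  obtain ⟨hv, U, W, hU, hW, hψ⟩ := h
  refine ⟨fun k => Finset.prod_pos fun i _ => hv _, matrixPow n U, matrixPow n W,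
    matrixPow_conjTranspose_mul_self n hU, matrixPow_conjTranspose_mul_self n hW, ?_⟩
  have h : ∀ a b, ψ (a, b) = ∑ k, U a k * ((Real.sqrt (v k) : ℝ) : ℂ) * W b k := fun a b => by
    have := congrFun (congrFun hψ a) b
    rw [Matrix.mul_apply] at this
    simpa [Matrix.mul_diagonal, coeffMatrix] using this
  ext a b
  rw [Matrix.mul_apply]
  simp only [coeffMatrix, LOCC.tensorPow, Matrix.of_apply, h, Matrix.mul_diagonal,
    Matrix.transpose_apply, matrixPow]
  rw [Finset.prod_univ_sum, Fintype.piFinset_univ]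
  refine Finset.sum_congr rfl fun k _ => ?_
  rw [Finset.prod_mul_distrib, Finset.prod_mul_distrib, Real.sqrt_prod _ fun i _ => (hv _).le,
    Complex.ofReal_prod]

end Schmidt

/-! ### Existence of the Schmidt decomposition -/

section SchmidtDecomposition

theorem partialTrace_pureState {A B : Type} [Fintype B] (ψ : A × B → ℂ) :
    partialTrace (pureState ψ) = coeffMatrix ψ * (coeffMatrix ψ)ᴴ := by
  ext a a'
  simp [partialTrace, pureState, coeffMatrix, Matrix.vecMulVec_apply, Matrix.mul_apply]

variable {A B : Type} [Fintype A] [Fintype B]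

theorem sum_eigenvalues_partialTrace [DecidableEq A] (ψ : A × B → ℂ) :
    ∑ i, (isHermitian_partialTrace_pureState ψ).eigenvalues i = ∑ p, ‖ψ p‖ ^ 2 := by
  have h := (isHermitian_partialTrace_pureState ψ).trace_eq_sum_eigenvalues
  have h2 : (partialTrace (pureState ψ)).trace = ((∑ p, ‖ψ p‖ ^ 2 : ℝ) : ℂ) := by
    rw [Fintype.sum_prod_type]
    simp [Matrix.trace, partialTrace, pureState, Matrix.vecMulVec_apply, Complex.mul_conj']
  apply Complex.ofReal_injective
  rw [← h2, h, Complex.ofReal_sum]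
  rfl

/-- The Schmidt decomposition. -/
theorem exists_hasSchmidt [DecidableEq A] [DecidableEq B] (ψ : A × B → ℂ) :
    ∃ (ι : Type) (_ : Fintype ι) (_ : DecidableEq ι) (v : ι → ℝ), HasSchmidt ψ v ∧
      ∑ k, v k = ∑ p, ‖ψ p‖ ^ 2 ∧ ∀ α, f α ψ = rpowSum v α := by
  classical
  set H := isHermitian_partialTrace_pureState ψ
  set V : Matrix A A ℂ := (H.eigenvectorUnitary : Matrix A A ℂ)
  have hV : Vᴴ * V = 1 := Unitary.coe_star_mul_self H.eigenvectorUnitary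
  have hV' : V * Vᴴ = 1 := Unitary.coe_mul_star_self H.eigenvectorUnitary
  -- In the eigenbasis of the reduced state, the rows of the coefficient matrix are orthogonal, and
  -- their squared norms are the eigenvalues. The nonzero rows, normalized, form the second Schmidt
  -- basis.
  set N : Matrix A B ℂ := Vᴴ * coeffMatrix ψ with hN
  have hNN : N * Nᴴ = Matrix.diagonal fun i => ((H.eigenvalues i : ℝ) : ℂ) := by
    have h1 := H.conjStarAlgAut_star_eigenvectorUnitary
    rw [Unitary.conjStarAlgAut_star_apply] at h1
    have h2 : N * Nᴴ = Vᴴ * partialTrace (pureState ψ) * V := by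
      rw [partialTrace_pureState, hN, Matrix.conjTranspose_mul, Matrix.conjTranspose_conjTranspose]
      simp only [Matrix.mul_assoc]
    rw [h2]
    exact h1
  have hNij : ∀ i j, ∑ b, N i b * star (N j b) =
      if i = j then ((H.eigenvalues i : ℝ) : ℂ) else 0 := fun i j => by
    have := congrFun (congrFun hNN i) j
    rwa [Matrix.mul_apply, Matrix.diagonal_apply] at this
  have hnn : ∀ i, H.eigenvalues i = ∑ b, ‖N i b‖ ^ 2 := fun i => by
    have := hNij i i
    simp only [RCLike.star_def, Complex.mul_conj', if_true] at this
    exact_mod_cast this.symm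
  have hnonneg : ∀ i, 0 ≤ H.eigenvalues i := fun i => by rw [hnn]; positivity
  have hzero : ∀ i, H.eigenvalues i = 0 → ∀ b, N i b = 0 := fun i hi b => by
    rw [hnn, Finset.sum_eq_zero_iff_of_nonneg fun _ _ => by positivity] at hi
    simpa using hi b (Finset.mem_univ b)
  have hpos : ∀ k : {i // H.eigenvalues i ≠ 0}, 0 < H.eigenvalues k := fun k =>
    lt_of_le_of_ne (hnonneg k) k.2.symm
  refine ⟨{i // H.eigenvalues i ≠ 0}, inferInstance, inferInstance, fun k => H.eigenvalues k,
    ⟨hpos, V.submatrix id Subtype.val,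
      Matrix.of fun b k => N k b / ((Real.sqrt (H.eigenvalues k) : ℝ) : ℂ), ?_, ?_, ?_⟩, ?_, ?_⟩
  · ext k l
    have := congrFun (congrFun hV k) l
    rw [Matrix.mul_apply] at this
    rw [Matrix.mul_apply]
    simp only [Matrix.conjTranspose_apply, Matrix.submatrix_apply, id_eq] at this ⊢
    rw [this]
    simp [Matrix.one_apply, Subtype.ext_iff]
  · ext k l
    rw [Matrix.mul_apply]
    have h1 : ∀ b, star (N k b / ((Real.sqrt (H.eigenvalues k) : ℝ) : ℂ)) *
        (N l b / ((Real.sqrt (H.eigenvalues l) : ℝ) : ℂ)) = (N l b * star (N k b)) /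
        (((Real.sqrt (H.eigenvalues k) : ℝ) : ℂ) * ((Real.sqrt (H.eigenvalues l) : ℝ) : ℂ)) := by
      intro b
      rw [star_div₀, RCLike.star_def, Complex.conj_ofReal]
      ring
    simp only [Matrix.conjTranspose_apply, Matrix.of_apply, h1, ← Finset.sum_div, hNij,
      Matrix.one_apply]
    by_cases hkl : k = l
    · subst hkl
      rw [if_pos rfl, if_pos rfl, ← Complex.ofReal_mul, Real.mul_self_sqrt (hnonneg _)]
      exact div_self (by exact_mod_cast k.2)
    · rw [if_neg hkl, if_neg (fun h => hkl (Subtype.ext h.symm)), zero_div]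
  · have h1 : coeffMatrix ψ = V * N := by rw [hN, ← Matrix.mul_assoc, hV', Matrix.one_mul]
    ext a b
    rw [h1, Matrix.mul_apply, Matrix.mul_apply]
    simp only [Matrix.mul_diagonal, Matrix.submatrix_apply, id_eq, Matrix.transpose_apply,
      Matrix.of_apply]
    have h2 : ∀ k : {i // H.eigenvalues i ≠ 0}, V a k * ((Real.sqrt (H.eigenvalues k) : ℝ) : ℂ) *
        (N k b / ((Real.sqrt (H.eigenvalues k) : ℝ) : ℂ)) = V a k * N k b := fun k => by
      have : ((Real.sqrt (H.eigenvalues k) : ℝ) : ℂ) ≠ 0 := by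
        exact_mod_cast (Real.sqrt_pos.2 (hpos k)).ne'
      field_simp
    simp only [h2]
    rw [← Finset.sum_subtype (Finset.univ.filter fun i => H.eigenvalues i ≠ 0) (by simp)
      fun i => V a i * N i b, Finset.sum_filter]
    refine Finset.sum_congr rfl fun i _ => ?_
    split_ifs with hi
    · rfl
    · rw [hzero i (not_not.1 hi), mul_zero]
  · rw [← sum_eigenvalues_partialTrace,
      ← Finset.sum_subtype (Finset.univ.filter fun i => H.eigenvalues i ≠ 0) (by simp)
      fun i => H.eigenvalues i, Finset.sum_filter_ne_zero]
  · intro α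
    rw [f, rpowSum, ← Finset.sum_subtype (Finset.univ.filter fun i => H.eigenvalues i ≠ 0) (by simp)
      fun i => H.eigenvalues i ^ α]

theorem nontrivial_of_hasSchmidt {ι : Type} [Fintype ι] [DecidableEq ι] [Nonempty ι]
    {φ : A × B → ℂ} {q : ι → ℝ} (h : HasSchmidt φ q)
    (hφ : ¬ ∃ (u : A → ℂ) (v : B → ℂ), ∀ a b, φ (a, b) = u a * v b) : Nontrivial ι := by
  by_contra hnt
  rw [not_nontrivial_iff_subsingleton] at hnt
  obtain ⟨-, U, W, -, -, h⟩ := h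
  obtain ⟨k⟩ := ‹Nonempty ι›
  refine hφ ⟨fun a => U a k * ((Real.sqrt (q k) : ℝ) : ℂ), fun b => W b k, fun a b => ?_⟩
  have := congrFun (congrFun h a) b
  rw [Matrix.mul_apply, Fintype.sum_subsingleton _ k] at this
  simpa [Matrix.mul_diagonal, coeffMatrix] using this

end SchmidtDecomposition

/-! ### The vectors of probability distributions -/

section Ket
variable {d : ℕ} {P : Fin d → ℝ}

/-- The indexing of `eigenvalues` need not follow the diagonal, so only the multisets of roots of
the characteristic polynomial are compared. -/
theorem sum_comp_eigenvalues_diagonal {n : Type*} [Fintype n] [DecidableEq n] {M : Matrix n n ℂ}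
    (hM : M.IsHermitian) {D : n → ℝ} (hD : M = Matrix.diagonal fun i => ((D i : ℝ) : ℂ))
    (g : ℝ → ℝ) : ∑ i, g (hM.eigenvalues i) = ∑ i, g (D i) := by
  have h1 := hM.roots_charpoly_eq_eigenvalues
  have h2 : M.charpoly.roots = Multiset.map (fun i => ((D i : ℝ) : ℂ)) Finset.univ.val := by
    rw [hD, Matrix.charpoly_diagonal, Polynomial.roots_prod]
    · simp
    · simp [Finset.prod_ne_zero_iff, Polynomial.X_sub_C_ne_zero]
  have h3 := congrArg (fun s => (Multiset.map (fun z : ℂ => g z.re) s).sum) (h1.symm.trans h2)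
  simpa [Multiset.map_map] using h3

theorem f_ket (hP : ∀ i, 0 ≤ P i) (α : ℝ) : f α (ket P) = powerSum α P := by
  have hD : partialTrace (pureState (ket P)) = Matrix.diagonal fun i => ((P i : ℝ) : ℂ) := by
    ext i j
    simp only [partialTrace, pureState, ket, Matrix.vecMulVec_apply, Matrix.of_apply,
      Matrix.diagonal_apply, Pi.star_apply]
    rw [Finset.sum_eq_single i (fun b _ hb => by simp [Ne.symm hb]) (by simp)]
    by_cases hij : i = j
    · subst hij
      simp only [if_true, RCLike.star_def, Complex.conj_ofReal]
      rw [← Complex.ofReal_mul, Real.mul_self_sqrt (hP i)]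
    · simp [hij, Ne.symm hij]
  rw [f, powerSum, Finset.sum_filter, Finset.sum_filter]
  exact sum_comp_eigenvalues_diagonal (isHermitian_partialTrace_pureState (ket P)) hD
    fun x => if x ≠ 0 then x ^ α else 0

/-- The restriction of `P` to its support. -/
def supp (P : Fin d → ℝ) : {i // P i ≠ 0} → ℝ := fun i => P i

theorem sum_supp {g : ℝ → ℝ} : ∑ i, g (supp P i) = ∑ i with P i ≠ 0, g (P i) :=
  (Finset.sum_subtype (Finset.univ.filter fun i => P i ≠ 0) (by simp) fun i => g (P i)).symm

theorem powerSum_eq (α : ℝ) : powerSum α P = rpowSum (supp P) α :=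
  (sum_supp (g := fun x => x ^ α)).symm

theorem renyi_eq (α : ℝ) : renyi α P = renyiEntropy (supp P) α := by
  rw [renyi, renyiEntropy, powerSum_eq, sum_supp (g := fun x => x * Real.log x), Finset.sum_filter]
  have : ∀ i, (if P i ≠ 0 then P i * Real.log (P i) else 0) = P i * Real.log (P i) := fun i => by
    split_ifs with h
    · rfl
    · simp [not_not.1 h]
  simp only [this]

theorem supp_pos (hP : P ∈ stdSimplex ℝ (Fin d)) (i : {i // P i ≠ 0}) : 0 < supp P i :=
  lt_of_le_of_ne (hP.1 i) i.2.symm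

theorem sum_supp_eq_one (hP : P ∈ stdSimplex ℝ (Fin d)) : ∑ i, supp P i = 1 := by
  rw [sum_supp (g := fun x => x), Finset.sum_filter_ne_zero]
  exact hP.2

theorem nontrivial_supp (hP : P ∈ stdSimplex ℝ (Fin d)) (hP1 : ∀ i, P i ≠ 1) :
    Nontrivial {i // P i ≠ 0} := by
  by_contra hnt
  rw [not_nontrivial_iff_subsingleton] at hnt
  have h := sum_supp_eq_one hP
  rcases isEmpty_or_nonempty {i // P i ≠ 0} with he | ⟨⟨k⟩⟩
  · simp at h
  · rw [Fintype.sum_subsingleton _ k] at h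
    exact hP1 k h

theorem hasSchmidt_ket (hP : P ∈ stdSimplex ℝ (Fin d)) : HasSchmidt (ket P) (supp P) := by
  have hU : ((Matrix.of fun (a : Fin d) (k : {i // P i ≠ 0}) => if a = k then (1 : ℂ) else 0)ᴴ *
      Matrix.of fun (a : Fin d) (k : {i // P i ≠ 0}) => if a = k then (1 : ℂ) else 0) = 1 := by
    ext k l
    simp [Matrix.mul_apply, Matrix.one_apply, Subtype.ext_iff, eq_comm]
  refine ⟨supp_pos hP, _, _, hU, hU, ?_⟩
  ext a b
  rw [Matrix.mul_apply]
  simp only [Matrix.mul_diagonal, Matrix.transpose_apply, Matrix.of_apply, coeffMatrix, ket, supp]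
  rw [← Finset.sum_subtype (Finset.univ.filter fun i => P i ≠ 0) (by simp)
    fun i => (if a = i then (1 : ℂ) else 0) * ((Real.sqrt (P i) : ℝ) : ℂ) *
      (if b = i then (1 : ℂ) else 0), Finset.sum_filter,
    Finset.sum_eq_single a (fun i _ hi => by simp [Ne.symm hi]) (by simp)]
  by_cases hab : a = b
  · subst hab
    by_cases h0 : P a = 0 <;> simp [h0]
  · simp [hab, Ne.symm hab]

end Ket

/-! ### The infimum of the entropy ratios -/

section Ratio
variable {ι κ : Type*} [Fintype ι] [Fintype κ] {p : ι → ℝ} {q : κ → ℝ}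

theorem renyiEntropy_nonneg (hp : ∀ i, 0 < p i) (hp1 : ∑ i, p i = 1) {α : ℝ} (hα : α ≤ 1) :
    0 ≤ renyiEntropy p α := by
  have hle := le_one_of_sum_eq_one hp hp1
  rw [renyiEntropy]
  split_ifs with h
  · exact neg_nonneg.2 (Finset.sum_nonpos fun i _ =>
      mul_nonpos_of_nonneg_of_nonpos (hp i).le (Real.log_nonpos (hp i).le (hle i)))
  · refine mul_nonneg (one_div_nonneg.2 (sub_nonneg.2 hα)) (Real.log_nonneg ?_)
    rw [← hp1]
    exact Finset.sum_le_sum fun i _ => Real.self_le_rpow_of_le_one (hp i).le (hle i) hα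

theorem renyiEntropy_pos [Nontrivial ι] (hp : ∀ i, 0 < p i) (hp1 : ∑ i, p i = 1) {α : ℝ}
    (hα : α ≤ 1) : 0 < renyiEntropy p α := by
  have hlt : ∀ i, p i < 1 := fun i => by
    obtain ⟨j, hj⟩ := exists_ne i
    rw [← hp1]
    exact Finset.single_lt_sum hj (Finset.mem_univ i) (Finset.mem_univ j) (hp j)
      fun k _ _ => (hp k).le
  rw [renyiEntropy]
  split_ifs with h
  · exact neg_pos.2 (Finset.sum_neg (fun i _ =>
      mul_neg_of_pos_of_neg (hp i) (Real.log_neg (hp i) (hlt i))) Finset.univ_nonempty)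
  · have hα1 : α < 1 := lt_of_le_of_ne hα h
    refine mul_pos (one_div_pos.2 (sub_pos.2 hα1)) (Real.log_pos ?_)
    rw [← hp1]
    exact Finset.sum_lt_sum_of_nonempty Finset.univ_nonempty fun i _ =>
      Real.self_lt_rpow_of_lt_one (hp i) (hlt i) hα1

theorem log_rpowSum_div (hp1 : ∑ i, p i = 1) (hq1 : ∑ i, q i = 1) {α : ℝ}
    (hα : α < 1) :
    Real.log (rpowSum p α) / Real.log (rpowSum q α) = renyiEntropy p α / renyiEntropy q α := by
  rw [log_rpowSum_eq hp1, log_rpowSum_eq hq1, mul_div_mul_left _ _ (sub_pos.2 hα).ne']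

theorem continuousOn_renyiEntropy_div [Nonempty ι] [Nontrivial κ] (hp : ∀ i, 0 < p i)
    (hp1 : ∑ i, p i = 1) (hq : ∀ i, 0 < q i) (hq1 : ∑ i, q i = 1) :
    ContinuousOn (fun α => renyiEntropy p α / renyiEntropy q α) (Set.Icc 0 1) :=
  (continuous_renyiEntropy hp hp1).continuousOn.div (continuous_renyiEntropy hq hq1).continuousOn
    fun _ hα => (renyiEntropy_pos hq hq1 hα.2).ne'

/-- By continuity the value at `1` is a limit of values on `[0,1)`, so including it does not lower
the infimum. -/
theorem iInf_Ico_eq_iInf_Icc {R : ℝ → ℝ} (hR : ContinuousOn R (Set.Icc 0 1))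
    (h0 : ∀ α ∈ Set.Icc (0 : ℝ) 1, 0 ≤ R α) :
    ⨅ α : Set.Ico (0 : ℝ) 1, R α = ⨅ α : Set.Icc (0 : ℝ) 1, R α := by
  have : Nonempty (Set.Ico (0 : ℝ) 1) := ⟨⟨0, by simp⟩⟩
  have hb : BddBelow (Set.range fun α : Set.Ico (0 : ℝ) 1 => R α) :=
    ⟨0, by rintro _ ⟨α, rfl⟩; exact h0 α (Set.Ico_subset_Icc_self α.2)⟩
  have hb' : BddBelow (Set.range fun α : Set.Icc (0 : ℝ) 1 => R α) :=
    ⟨0, by rintro _ ⟨α, rfl⟩; exact h0 α α.2⟩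
  refine le_antisymm (le_ciInf fun α => ?_) (le_ciInf fun α => ?_)
  · rcases eq_or_lt_of_le α.2.2 with h1 | h1
    · have hlim : Tendsto R (𝓝[Set.Ico 0 1] 1) (𝓝 (R 1)) :=
        (hR 1 (by simp)).mono_left (nhdsWithin_mono _ Set.Ico_subset_Icc_self)
      have : (𝓝[Set.Ico (0 : ℝ) 1] 1).NeBot := by
        rw [nhdsWithin_Ico_eq_nhdsLT one_pos]; infer_instance
      rw [h1]
      exact ge_of_tendsto hlim (eventually_mem_nhdsWithin.mono fun β hβ => ciInf_le hb ⟨β, hβ⟩)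
    · exact ciInf_le hb ⟨α, α.2.1, h1⟩
  · exact ciInf_le hb' ⟨α, Set.Ico_subset_Icc_self α.2⟩

theorem isLeast_iInf_Icc {R : ℝ → ℝ} (hR : ContinuousOn R (Set.Icc 0 1)) :
    IsLeast (R '' Set.Icc 0 1) (⨅ α : Set.Icc (0 : ℝ) 1, R α) := by
  rw [iInf, show Set.range (fun α : Set.Icc (0 : ℝ) 1 => R α) = R '' Set.Icc 0 1 from
    (Set.image_eq_range R _).symm]
  exact (isCompact_Icc.image_of_continuousOn hR).isLeast_sInf ⟨R 0, 0, by simp, rfl⟩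

end Ratio

/-! ### From entropies to conversions -/

theorem exists_tendsto_converts {A B A' B' : Type} [Fintype A] [Fintype B] [Fintype A'] [Fintype B']
    [DecidableEq A] [DecidableEq B] [DecidableEq A'] [DecidableEq B'] {ι κ : Type} [Fintype ι]
    [Fintype κ] [DecidableEq ι] [DecidableEq κ] [Nonempty ι] [Nonempty κ] {ψ : A × B → ℂ}
    {φ : A' × B' → ℂ} {p : ι → ℝ} {q : κ → ℝ} (hψ : HasSchmidt ψ p) (hφ : HasSchmidt φ q)
    (hp1 : ∑ i, p i = 1) (hq1 : ∑ i, q i = 1) {r : ℝ}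
    (h : ∀ α ∈ Set.Icc (0 : ℝ) 1, r * renyiEntropy q α < renyiEntropy p α) :
    ∃ x : ℕ → ℝ, (∀ n, 1 ≤ x n) ∧ Tendsto x atTop (𝓝 1) ∧ ∀ N M : ℕ, (M : ℝ) = r * N →
      Converts (((Real.sqrt (x N) : ℝ) : ℂ) • tensorPow N ψ) (tensorPow M φ) := by
  obtain ⟨x, hx1, hx, hmin⟩ := exists_tendsto_sum_min_le hψ.1 hp1 hφ.1 hq1 h
  exact ⟨x, hx1, hx, fun N M hM => converts_of_hasSchmidt
    ((hψ.tensorPow N).smul (one_pos.trans_le (hx1 N))) (hφ.tensorPow M) (hmin N M hM)⟩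

theorem nonempty_of_sum_eq_one {ι : Type*} [Fintype ι] {p : ι → ℝ} (hp1 : ∑ i, p i = 1) :
    Nonempty ι := by
  by_contra h
  rw [not_nonempty_iff] at h
  simp at hp1

theorem mul_renyiEntropy_lt {ι κ : Type*} [Fintype ι] [Fintype κ] [Nontrivial κ] {p : ι → ℝ}
    {q : κ → ℝ} (hp : ∀ i, 0 < p i) (hp1 : ∑ i, p i = 1) (hq : ∀ i, 0 < q i) (hq1 : ∑ i, q i = 1)
    {r : ℝ} (h : r < ⨅ α : Set.Icc (0 : ℝ) 1, renyiEntropy p α / renyiEntropy q α) (α : ℝ)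
    (hα : α ∈ Set.Icc (0 : ℝ) 1) : r * renyiEntropy q α < renyiEntropy p α := by
  rw [← lt_div_iff₀ (renyiEntropy_pos hq hq1 hα.2)]
  refine h.trans_le (ciInf_le ⟨0, ?_⟩ (⟨α, hα⟩ : Set.Icc (0 : ℝ) 1))
  rintro _ ⟨β, rfl⟩
  exact div_nonneg (renyiEntropy_nonneg hp hp1 β.2.2) (renyiEntropy_nonneg hq hq1 β.2.2)

theorem iInf_log_rpowSum_div {ι κ : Type*} [Fintype ι] [Fintype κ] [Nonempty ι] [Nontrivial κ]
    {p : ι → ℝ} {q : κ → ℝ} (hp : ∀ i, 0 < p i) (hp1 : ∑ i, p i = 1) (hq : ∀ i, 0 < q i)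
    (hq1 : ∑ i, q i = 1) :
    ⨅ α : Set.Ico (0 : ℝ) 1, Real.log (rpowSum p α) / Real.log (rpowSum q α) =
      ⨅ α : Set.Icc (0 : ℝ) 1, renyiEntropy p α / renyiEntropy q α := by
  rw [← iInf_Ico_eq_iInf_Icc (R := fun α => renyiEntropy p α / renyiEntropy q α)
    (continuousOn_renyiEntropy_div hp hp1 hq hq1) fun α hα =>
    div_nonneg (renyiEntropy_nonneg hp hp1 hα.2) (renyiEntropy_nonneg hq hq1 hα.2)]
  exact iInf_congr fun α => log_rpowSum_div hp1 hq1 α.2.2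

end LOCC

theorem mainTheorem7 :
    -- two probability distributions, the second of which is not a point mass
    (∀ (d₁ d₂ : ℕ) (P : Fin d₁ → ℝ) (Q : Fin d₂ → ℝ),
      P ∈ stdSimplex ℝ (Fin d₁) → Q ∈ stdSimplex ℝ (Fin d₂) → (∀ i, Q i ≠ 1) →
      -- the three forms of the rate, the last of which is a minimum
      ((⨅ α : Set.Ico (0 : ℝ) 1,
            Real.log (LOCC.f α (LOCC.ket P)) / Real.log (LOCC.f α (LOCC.ket Q))) =
          ⨅ α : Set.Ico (0 : ℝ) 1,
            Real.log (LOCC.powerSum α P) / Real.log (LOCC.powerSum α Q)) ∧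
      ((⨅ α : Set.Ico (0 : ℝ) 1,
            Real.log (LOCC.powerSum α P) / Real.log (LOCC.powerSum α Q)) =
          ⨅ α : Set.Icc (0 : ℝ) 1, LOCC.renyi α P / LOCC.renyi α Q) ∧
      IsLeast ((fun α : ℝ => LOCC.renyi α P / LOCC.renyi α Q) '' Set.Icc (0 : ℝ) 1)
        (⨅ α : Set.Icc (0 : ℝ) 1, LOCC.renyi α P / LOCC.renyi α Q) ∧
      -- the proposition
      (1 < (⨅ α : Set.Icc (0 : ℝ) 1, LOCC.renyi α P / LOCC.renyi α Q) →
        ∃ x : ℕ → ℝ, (∀ n, 1 ≤ x n) ∧ Tendsto x atTop (𝓝 1) ∧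
          ∀ᶠ n in atTop,
            LOCC.Converts (((Real.sqrt (x n) : ℝ) : ℂ) • LOCC.tensorPow n (LOCC.ket P))
              (LOCC.tensorPow n (LOCC.ket Q)))) ∧
    -- the corollary, for normalized bipartite vectors, the second of which is not a product vector
    (∀ (A B A' B' : Type) [Fintype A] [Fintype B] [Fintype A'] [Fintype B']
      [DecidableEq A] [DecidableEq B] [DecidableEq A'] [DecidableEq B']
      (ψ : A × B → ℂ) (φ : A' × B' → ℂ),
      ∑ p, ‖ψ p‖ ^ 2 = 1 → ∑ p, ‖φ p‖ ^ 2 = 1 →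
      (¬ ∃ (u : A' → ℂ) (v : B' → ℂ), ∀ a b, φ (a, b) = u a * v b) →
      ∀ n m : ℕ, 0 < n →
        (m : ℝ) / n < (⨅ α : Set.Ico (0 : ℝ) 1,
          Real.log (LOCC.f α ψ) / Real.log (LOCC.f α φ)) →
        ∃ x : ℕ → ℝ, (∀ k, 1 ≤ x k) ∧ Tendsto x atTop (𝓝 1) ∧
          ∀ k, LOCC.Converts (((Real.sqrt (x k) : ℝ) : ℂ) • LOCC.tensorPow (n * k) ψ)
            (LOCC.tensorPow (m * k) φ)) := by
  refine ⟨fun d₁ d₂ P Q hP hQ hQ1 => ?_,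
    fun A B A' B' _ _ _ _ _ _ _ _ ψ φ hψ hφ hprod n m hn h => ?_⟩
  · have hp := LOCC.supp_pos hP
    have hp1 := LOCC.sum_supp_eq_one hP
    have hq := LOCC.supp_pos hQ
    have hq1 := LOCC.sum_supp_eq_one hQ
    have := LOCC.nontrivial_supp hQ hQ1
    have := LOCC.nonempty_of_sum_eq_one hp1
    simp only [LOCC.f_ket hP.1, LOCC.f_ket hQ.1, LOCC.powerSum_eq, LOCC.renyi_eq]
    refine ⟨trivial, LOCC.iInf_log_rpowSum_div hp hp1 hq hq1,
      LOCC.isLeast_iInf_Icc (LOCC.continuousOn_renyiEntropy_div hp hp1 hq hq1), fun h => ?_⟩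
    obtain ⟨x, hx1, hx, hconv⟩ := LOCC.exists_tendsto_converts (LOCC.hasSchmidt_ket hP)
      (LOCC.hasSchmidt_ket hQ) hp1 hq1 (LOCC.mul_renyiEntropy_lt hp hp1 hq hq1 h)
    -- Here `r = 1`.
    exact ⟨x, hx1, hx, Eventually.of_forall fun n => hconv n n (one_mul _).symm⟩
  · obtain ⟨ι, _, _, p, hp, hp1, hpf⟩ := LOCC.exists_hasSchmidt ψ
    obtain ⟨κ, _, _, q, hq, hq1, hqf⟩ := LOCC.exists_hasSchmidt φ
    rw [hψ] at hp1
    rw [hφ] at hq1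
    have := LOCC.nonempty_of_sum_eq_one hp1
    have := LOCC.nonempty_of_sum_eq_one hq1
    have := LOCC.nontrivial_of_hasSchmidt hq hprod
    simp only [hpf, hqf] at h
    rw [LOCC.iInf_log_rpowSum_div hp.1 hp1 hq.1 hq1] at h
    obtain ⟨x, hx1, hx, hconv⟩ := LOCC.exists_tendsto_converts hp hq hp1 hq1
      (LOCC.mul_renyiEntropy_lt hp.1 hp1 hq.1 hq1 h)
    have hn' : (n : ℝ) ≠ 0 := by exact_mod_cast hn.ne'
    -- Here `r = m / n`, with `N = n * k` and `M = m * k`, so `M = r * N` holds exactly.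
    refine ⟨fun k => x (n * k), fun k => hx1 _, hx.comp (tendsto_id.const_mul_atTop' hn),
      fun k => hconv _ _ ?_⟩
    push_cast
    field_simp
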